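/- Let $n\ge 1$ be an integer, and let $p_*=\infty$ if $n\le 2$ and $p_*=\frac{n+2}{n-2}$ if $n\ge 3$. Let $p$ be a real number with $1<p<p_*$, and let $u:\mathbb R^n\to\mathbb R$ be a nonnegative classical (that is, $C^2$) solution of $$\Delta u-\tfrac12\, x\cdot\nabla u+|u|^{p-1}u-\tfrac{1}{p-1}\,u=0\qquad\text{on all of }\mathbb R^n .$$ No boundedness of $u$ is assumed. Then $\nabla u\equiv 0$ on $\mathbb R^n$; in particular, $u$ is constant. -/

import Mathlib

/-- The critical Sobolev exponent `p_*` in dimension `n`: it is `∞` if `n ≤ 2`, and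
`(n + 2) / (n - 2)` if `n ≥ 3`. -/
noncomputable def criticalExponent (n : ℕ) : EReal :=
  if n ≤ 2 then ⊤ else ((((n : ℝ) + 2) / ((n : ℝ) - 2) : ℝ) : EReal)

/-- `u` is a classical (i.e. twice continuously differentiable) solution on all of `ℝⁿ` of
`Δu - (1/2) x · ∇u + |u|^(p-1) u - u / (p-1) = 0`. -/
structure IsClassicalSolution (n : ℕ) (p : ℝ) (u : EuclideanSpace ℝ (Fin n) → ℝ) : Prop where
  contDiff : ContDiff ℝ 2 u
  equation : ∀ x : EuclideanSpace ℝ (Fin n),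
    Laplacian.laplacian u x - (1 / 2) * inner ℝ x (gradient u x)
      + |u x| ^ (p - 1) * u x - (1 / (p - 1)) * u x = 0

/-!
Write `β = 1 / (p - 1)` and `ρ(x) = exp (-|x|² / 4)`. For bounded solutions the result is due to
Giga and Kohn: testing the equation, in the form `div (ρ ∇u) = ρ (β u - u ^ p)`, with a suitable
combination of `x · ∇u`, `u` and `|x|² u` gives a Pohozaev identity

`∫ ρ (κ₁ |∇u|² + κ₂ |x|² |∇u|²) = 0`, with `κ₁ = ((n + 2) - (n - 2) p) / (2 (p + 1))` and
`κ₂ = (p - 1) / (4 (p + 1))`,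

in which both coefficients are positive because `p` is subcritical
(`integral_pohozaev_eq_zero`). Without a bound on `u`, the identity holds only up to terms coming
from a cutoff at scale `R`. These carry the factor `exp (-R² / 4)`, so they vanish in the limit as
soon as the integrals of `|∇u|²`, `u ^ (p + 1)` and `u²` over balls of radius `R` grow polynomially
(`gradient_eq_zero_of_energy_growth`).

The polynomial growth comes from the integral method of Gidas and Spruck
(`gidas_spruck_integral_nonneg`), with the exponent `q = (1 - p) / 2`. For this `q` the method
closes for every subcritical `p`, and `q + 2 p` exceeds `p + 1`. The drift and the derivatives of
the cutoff produce lower order terms, which are absorbed at the cost of powers of `R`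
(`exists_integral_gidas_spruck_le`). Two points need care.

* In low dimensions `q + 2` may be negative, and then the remainder is large where `u` is small.
  The minimum principle with the barrier `(1 + |x - z|²) ^ (-m)` shows that `u` is either
  identically zero or bounded below by a negative power of `|x|`
  (`exists_rpow_le_of_supersolution`); this also gives the positivity of `u`, needed to form
  negative powers.
* The Gidas–Spruck method rests on Bochner's formula, which involves third derivatives, while `u` is
  only of class `C²`. Its integrated form is a consequence of the null Lagrangian property of
  `2 × 2` Jacobians, which holds for functions of class `C¹`
  (`integral_fderiv_mul_fderiv_comm`, `integral_hessian_sq_sub_laplacian_sq`).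
-/

section

open MeasureTheory Module Topology Filter InnerProductSpace Set
open scoped Gradient Laplacian

/-! ### Green's identity and the weak Bochner formula -/

section Calculus

variable {E : Type*} [NormedAddCommGroup E] [InnerProductSpace ℝ E] [FiniteDimensional ℝ E]

theorem laplacian_eq_sum_fderiv {ι : Type*} [Fintype ι] (b : OrthonormalBasis ι ℝ E) (u : E → ℝ)
    (x : E) : Δ u x = ∑ i, fderiv ℝ (fderiv ℝ u) x (b i) (b i) := by
  rw [laplacian_eq_iteratedFDeriv_orthonormalBasis u b]
  simp [iteratedFDeriv_two_apply]

theorem continuous_laplacian {u : E → ℝ} (hu : ContDiff ℝ 2 u) : Continuous (Δ u) := by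
  have h2 : Continuous (fderiv ℝ (fderiv ℝ u)) :=
    (hu.fderiv_right (m := 1) (by norm_num)).continuous_fderiv one_ne_zero
  have : Δ u = fun x => ∑ i, fderiv ℝ (fderiv ℝ u) x
      (stdOrthonormalBasis ℝ E i) (stdOrthonormalBasis ℝ E i) :=
    funext fun x => laplacian_eq_sum_fderiv _ u x
  rw [this]
  fun_prop

theorem contDiff_gradient {u : E → ℝ} (hu : ContDiff ℝ 2 u) : ContDiff ℝ 1 (∇ u) :=
  (toDual ℝ E).symm.contDiff.comp (hu.fderiv_right (m := 1) (by norm_num))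

theorem fderiv_gradient_apply {u : E → ℝ} (hu : ContDiff ℝ 2 u) (x v w : E) :
    inner ℝ (fderiv ℝ (∇ u) x v) w = fderiv ℝ (fderiv ℝ u) x v w := by
  have h1 : HasFDerivAt (fderiv ℝ u) (fderiv ℝ (fderiv ℝ u) x) x :=
    (((hu.fderiv_right (m := 1) (by norm_num)).differentiable one_ne_zero) x).hasFDerivAt
  have h2 : HasFDerivAt (∇ u) _ x :=
    ((toDual ℝ E).symm.toContinuousLinearEquiv.toContinuousLinearMap.hasFDerivAt).comp x h1
  rw [h2.fderiv]
  simp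

omit [FiniteDimensional ℝ E] in
theorem fderiv_fderiv_symm {u : E → ℝ} (hu : ContDiff ℝ 2 u) (x v w : E) :
    fderiv ℝ (fderiv ℝ u) x v w = fderiv ℝ (fderiv ℝ u) x w v :=
  (hu.contDiffAt.isSymmSndFDerivAt (by simp)) v w

theorem fderiv_norm_sq_gradient {u : E → ℝ} (hu : ContDiff ℝ 2 u) (x v : E) :
    fderiv ℝ (fun y => ‖∇ u y‖ ^ 2) x v = 2 * fderiv ℝ (fderiv ℝ u) x v (∇ u x) := by
  have h := (((contDiff_gradient hu).differentiable one_ne_zero) x).hasFDerivAt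
  rw [h.norm_sq.fderiv]
  simp [← fderiv_gradient_apply hu]

theorem fderiv_inner_gradient {u : E → ℝ} (hu : ContDiff ℝ 2 u) (x v : E) :
    fderiv ℝ (fun y => inner ℝ y (∇ u y)) x v
      = fderiv ℝ u x v + fderiv ℝ (fderiv ℝ u) x v x := by
  have h := (((contDiff_gradient hu).differentiable one_ne_zero) x).hasFDerivAt
  have h' : HasFDerivAt (fun y => inner ℝ y (∇ u y)) _ x := (hasFDerivAt_id x).inner ℝ h
  rw [h'.fderiv]
  simp [← fderiv_gradient_apply hu, real_inner_comm]
  ring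

theorem fderiv_apply_gradient_eq_sum {ι : Type*} [Fintype ι] (b : OrthonormalBasis ι ℝ E)
    (L : E →L[ℝ] ℝ) (w : E → ℝ) (x : E) :
    L (∇ w x) = ∑ i, L (b i) * fderiv ℝ w x (b i) := by
  conv_lhs => rw [← b.sum_repr' (∇ w x)]
  simp [inner_gradient_right, mul_comm]

theorem fderiv_apply_gradient_self (u : E → ℝ) (x : E) :
    fderiv ℝ u x (∇ u x) = ‖∇ u x‖ ^ 2 := by
  rw [← inner_gradient_left, real_inner_self_eq_norm_sq]

theorem fderiv_apply_gradient_comm (u v : E → ℝ) (x : E) :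
    fderiv ℝ u x (∇ v x) = fderiv ℝ v x (∇ u x) := by
  rw [← inner_gradient_left, ← inner_gradient_left, real_inner_comm]

variable [MeasurableSpace E] [BorelSpace E]

theorem integral_fderiv_eq_zero_of_hasCompactSupport {F : E → ℝ} (hF : ContDiff ℝ 1 F)
    (hc : HasCompactSupport F) (v : E) : ∫ x, fderiv ℝ F x v = 0 := by
  have h1 : Continuous fun x => fderiv ℝ F x v :=
    (hF.continuous_fderiv one_ne_zero).clm_apply continuous_const
  have := integral_mul_fderiv_eq_neg_fderiv_mul_of_integrable (μ := (volume : Measure E))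
    (f := fun _ : E => (1 : ℝ)) (g := F) (v := v) (by simp)
    (by simpa using h1.integrable_of_hasCompactSupport (hc.fderiv_apply (𝕜 := ℝ) v))
    (by simpa using hF.continuous.integrable_of_hasCompactSupport hc)
    (fun x _ => differentiableAt_const _) (fun x _ => (hF.differentiable one_ne_zero) x)
  simpa using this

/-- Green's first identity: the divergence of `ψ ∇w` has integral zero. -/
theorem integral_mul_laplacian_add_fderiv_gradient {ψ w : E → ℝ} (hψ : ContDiff ℝ 1 ψ)
    (hw : ContDiff ℝ 2 w) (hc : HasCompactSupport ψ ∨ HasCompactSupport w) :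
    Integrable (fun x => ψ x * Δ w x + fderiv ℝ ψ x (∇ w x)) ∧
    ∫ x, (ψ x * Δ w x + fderiv ℝ ψ x (∇ w x)) = 0 := by
  set b := stdOrthonormalBasis ℝ E
  have hw1 : ContDiff ℝ 1 (fderiv ℝ w) := hw.fderiv_right (m := 1) (by norm_num)
  have hF : ∀ i, ContDiff ℝ 1 (fun x => ψ x * fderiv ℝ w x (b i)) := fun i =>
    hψ.mul (hw1.clm_apply contDiff_const)
  have hFc : ∀ i, HasCompactSupport (fun x => ψ x * fderiv ℝ w x (b i)) := by
    intro i
    rcases hc with hc | hc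
    · exact hc.mul_right
    · exact (hc.fderiv_apply (𝕜 := ℝ) (b i)).mul_left
  have hint : ∀ i, Integrable (fun x => fderiv ℝ (fun x => ψ x * fderiv ℝ w x (b i)) x (b i)) :=
    fun i => (((hF i).continuous_fderiv one_ne_zero).clm_apply
      continuous_const).integrable_of_hasCompactSupport ((hFc i).fderiv_apply (𝕜 := ℝ) (b i))
  have key : (fun x => ψ x * Δ w x + fderiv ℝ ψ x (∇ w x)) =
      fun x => ∑ i, fderiv ℝ (fun x => ψ x * fderiv ℝ w x (b i)) x (b i) := by
    funext x
    rw [laplacian_eq_sum_fderiv b, fderiv_apply_gradient_eq_sum b, Finset.mul_sum,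
      ← Finset.sum_add_distrib]
    refine Finset.sum_congr rfl fun i _ => ?_
    have h1 := ((hψ.differentiable one_ne_zero) x).hasFDerivAt
    have h2 := ((hw1.differentiable one_ne_zero) x).hasFDerivAt
    have h3 : HasFDerivAt (fun x => fderiv ℝ w x (b i)) _ x := h2.clm_apply (hasFDerivAt_const _ x)
    rw [(h1.fun_mul h3).fderiv]
    simp [mul_comm]
  rw [key]
  refine ⟨integrable_finsetSum _ fun i _ => hint i, ?_⟩
  rw [integral_finsetSum _ fun i _ => hint i]
  exact Finset.sum_eq_zero fun i _ =>
    integral_fderiv_eq_zero_of_hasCompactSupport (hF i) (hFc i) _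

/-- The Jacobian determinant `∂ₐH ∂ᵦG - ∂ᵦH ∂ₐG` is a null Lagrangian. For functions of class `C¹`
only, one derivative is replaced by a difference quotient, which commutes with the other one. -/
theorem integral_fderiv_mul_fderiv_comm {H G : E → ℝ} (hH : ContDiff ℝ 1 H)
    (hG : ContDiff ℝ 1 G) (hc : HasCompactSupport H) (a b : E) :
    ∫ x, fderiv ℝ H x a * fderiv ℝ G x b = ∫ x, fderiv ℝ H x b * fderiv ℝ G x a := by
  wlog hGc : HasCompactSupport G generalizing G
  · obtain ⟨R, hR0, hR⟩ := (IsCompact.isBounded hc).subset_ball_lt 0 0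
    let χ : ContDiffBump (0 : E) := ⟨R, R + 1, hR0, by linarith⟩
    have key : ∀ v w x, fderiv ℝ H x v * fderiv ℝ G x w
        = fderiv ℝ H x v * fderiv ℝ (fun x => χ x * G x) x w := by
      intro v w x
      by_cases hx : x ∈ tsupport H
      · have : (fun x => χ x * G x) =ᶠ[𝓝 x] G := by
          filter_upwards [Metric.isOpen_ball.mem_nhds (hR hx)] with y hy
          rw [χ.one_of_mem_closedBall (Metric.ball_subset_closedBall hy), one_mul]
        rw [this.fderiv_eq]
      · rw [fderiv_of_notMem_tsupport ℝ hx]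
        simp
    simp_rw [key]
    exact this (χ.contDiff.mul hG) χ.hasCompactSupport.mul_right
  obtain ⟨C, hHL⟩ := hH.lipschitzWith_of_hasCompactSupport hc one_ne_zero
  obtain ⟨D, hGL⟩ := hG.lipschitzWith_of_hasCompactSupport hGc one_ne_zero
  have hHd : ∀ x, DifferentiableAt ℝ H x := hH.differentiable one_ne_zero
  have hGd : ∀ x, DifferentiableAt ℝ G x := hG.differentiable one_ne_zero
  have cH : ∀ v, Continuous fun x => fderiv ℝ H x v := fun v =>
    (hH.continuous_fderiv one_ne_zero).clm_apply continuous_const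
  have cG : ∀ v, Continuous fun x => fderiv ℝ G x v := fun v =>
    (hG.continuous_fderiv one_ne_zero).clm_apply continuous_const
  have sH : ∀ v, HasCompactSupport fun x => fderiv ℝ H x v := hc.fderiv_apply (𝕜 := ℝ)
  have sG : ∀ v, HasCompactSupport fun x => fderiv ℝ G x v := hGc.fderiv_apply (𝕜 := ℝ)
  have lim1 := hHL.integral_inv_smul_sub_mul_tendsto_integral_lineDeriv_mul
    (μ := volume) (g := fun x => fderiv ℝ G x b)
    ((cG b).integrable_of_hasCompactSupport (sG b)) a
  have lim2 := hGL.integral_inv_smul_sub_mul_tendsto_integral_lineDeriv_mul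
    (μ := volume) (g := fun x => -fderiv ℝ H x b)
    ((cH b).integrable_of_hasCompactSupport (sH b)).neg (-a)
  have heq : ∀ t : ℝ, ∫ x, (t⁻¹ • (H (x + t • a) - H x)) * fderiv ℝ G x b
      = ∫ x, (t⁻¹ • (G (x + t • -a) - G x)) * -fderiv ℝ H x b := by
    intro t
    have hshift : ContDiff ℝ 1 fun x => H (x + t • a) := by fun_prop
    have hshiftd : ∀ x, fderiv ℝ (fun x => H (x + t • a)) x = fderiv ℝ H (x + t • a) := fun x =>
      fderiv_comp_add_right _
    have hFd : ∀ x, fderiv ℝ (fun x => t⁻¹ * (H (x + t • a) - H x)) x b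
        = t⁻¹ * (fderiv ℝ H (x + t • a) b - fderiv ℝ H x b) := by
      intro x
      rw [fderiv_const_mul ((hshift.differentiable one_ne_zero x).fun_sub (hHd x)),
        fderiv_fun_sub (hshift.differentiable one_ne_zero x) (hHd x), hshiftd]
      simp
    have i1 : Integrable fun x => fderiv ℝ H (x + t • a) b * G x :=
      ((((cH b).comp (continuous_id.add continuous_const)).mul
        hG.continuous).integrable_of_hasCompactSupport hGc.mul_left)
    have i2 : Integrable fun x => fderiv ℝ H x b * G x :=
      ((cH b).mul hG.continuous).integrable_of_hasCompactSupport hGc.mul_left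
    have i3 : Integrable fun x => fderiv ℝ H x b * G (x + t • -a) :=
      ((cH b).mul (hG.continuous.comp
        (continuous_id.add continuous_const))).integrable_of_hasCompactSupport (sH b).mul_right
    have ibp := integral_mul_fderiv_eq_neg_fderiv_mul_of_integrable (μ := (volume : Measure E))
      (f := fun x => t⁻¹ * (H (x + t • a) - H x)) (g := G) (v := b)
      (by simp_rw [hFd, mul_assoc, sub_mul]; exact (i1.sub i2).const_mul _)
      ((((hshift.continuous.sub hH.continuous).const_mul _).mul
        (cG b)).integrable_of_hasCompactSupport (sG b).mul_left)
      ((((hshift.continuous.sub hH.continuous).const_mul _).mul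
        hG.continuous).integrable_of_hasCompactSupport hGc.mul_left)
      (fun x _ => ((hshift.differentiable one_ne_zero x).fun_sub (hHd x)).const_mul _)
      (fun x _ => hGd x)
    simp only [smul_eq_mul]
    rw [ibp]
    simp_rw [hFd, mul_neg, mul_assoc, integral_neg, integral_const_mul]
    have hG' : (fun x => (G (x + t • -a) - G x) * fderiv ℝ H x b) =
        fun x => fderiv ℝ H x b * G (x + t • -a) - fderiv ℝ H x b * G x := by
      funext x; ring
    simp_rw [hG', sub_mul]
    rw [integral_sub i1 i2, integral_sub i3 i2,
      ← integral_add_right_eq_self (fun x => fderiv ℝ H x b * G (x + t • -a)) (t • a)]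
    simp [add_assoc]
  have := tendsto_nhds_unique lim1 (lim2.congr fun t => (heq t).symm)
  simp_rw [fun x v => (hHd x).lineDeriv_eq_fderiv (v := v),
    fun x v => (hGd x).lineDeriv_eq_fderiv (v := v)] at this
  rw [this]
  exact integral_congr_ae (Eventually.of_forall fun x => by simp [mul_comm])

/-- The weak form of Bochner's formula: for `u` of class `C²` only, the third derivatives are
avoided by the null Lagrangian identity applied to `ψ ∂ᵢu` and `∂ⱼu`. -/
theorem integral_hessian_sq_sub_laplacian_sq {ι : Type*} [Fintype ι] (b : OrthonormalBasis ι ℝ E)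
    {u ψ : E → ℝ} (hu : ContDiff ℝ 2 u) (hψ : ContDiff ℝ 1 ψ) (hc : HasCompactSupport ψ) :
    Integrable (fun x => ψ x * ∑ i, ∑ j, (fderiv ℝ (fderiv ℝ u) x (b i) (b j)) ^ 2
      + fderiv ℝ ψ x (fderiv ℝ (∇ u) x (∇ u x))
      - ψ x * (Δ u x) ^ 2 - Δ u x * fderiv ℝ ψ x (∇ u x)) ∧
    ∫ x, (ψ x * ∑ i, ∑ j, (fderiv ℝ (fderiv ℝ u) x (b i) (b j)) ^ 2
      + fderiv ℝ ψ x (fderiv ℝ (∇ u) x (∇ u x))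
      - ψ x * (Δ u x) ^ 2 - Δ u x * fderiv ℝ ψ x (∇ u x)) = 0 := by
  have hu1 : ContDiff ℝ 1 (fderiv ℝ u) := hu.fderiv_right (m := 1) (by norm_num)
  have cu : ∀ i, ContDiff ℝ 1 fun x => fderiv ℝ u x (b i) := fun i => hu1.clm_apply contDiff_const
  have du : ∀ i x v, fderiv ℝ (fun x => fderiv ℝ u x (b i)) x v
      = fderiv ℝ (fderiv ℝ u) x v (b i) := by
    intro i x v
    have h2 := ((hu1.differentiable one_ne_zero) x).hasFDerivAt
    have h3 : HasFDerivAt (fun x => fderiv ℝ u x (b i)) _ x := h2.clm_apply (hasFDerivAt_const _ x)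
    rw [h3.fderiv]; simp
  have cH : ∀ i, ContDiff ℝ 1 fun x => ψ x * fderiv ℝ u x (b i) := fun i => hψ.mul (cu i)
  have sH : ∀ i, HasCompactSupport fun x => ψ x * fderiv ℝ u x (b i) := fun i => hc.mul_right
  have dH : ∀ i x v, fderiv ℝ (fun x => ψ x * fderiv ℝ u x (b i)) x v
      = ψ x * fderiv ℝ (fderiv ℝ u) x v (b i) + fderiv ℝ ψ x v * fderiv ℝ u x (b i) := by
    intro i x v
    have h1 := ((hψ.differentiable one_ne_zero) x).hasFDerivAt
    rw [(h1.fun_mul ((cu i).differentiable one_ne_zero x).hasFDerivAt).fderiv]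
    simp [du, mul_comm]
  have int : ∀ i j v w, Integrable fun x => fderiv ℝ (fun x => ψ x * fderiv ℝ u x (b i)) x v *
      fderiv ℝ (fun x => fderiv ℝ u x (b j)) x w := fun i j v w =>
    ((((cH i).continuous_fderiv one_ne_zero).clm_apply continuous_const).mul
      (((cu j).continuous_fderiv one_ne_zero).clm_apply
        continuous_const)).integrable_of_hasCompactSupport
      ((sH i).fderiv_apply (𝕜 := ℝ) v).mul_right
  have key : (fun x => ψ x * ∑ i, ∑ j, (fderiv ℝ (fderiv ℝ u) x (b i) (b j)) ^ 2
      + fderiv ℝ ψ x (fderiv ℝ (∇ u) x (∇ u x))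
      - ψ x * (Δ u x) ^ 2 - Δ u x * fderiv ℝ ψ x (∇ u x)) = fun x => ∑ i, ∑ j,
      (fderiv ℝ (fun x => ψ x * fderiv ℝ u x (b i)) x (b j) *
        fderiv ℝ (fun x => fderiv ℝ u x (b j)) x (b i)
      - fderiv ℝ (fun x => ψ x * fderiv ℝ u x (b i)) x (b i) *
        fderiv ℝ (fun x => fderiv ℝ u x (b j)) x (b j)) := by
    funext x
    have e1 : fderiv ℝ ψ x (fderiv ℝ (∇ u) x (∇ u x)) = ∑ i, ∑ j,
        fderiv ℝ ψ x (b j) * fderiv ℝ u x (b i) * fderiv ℝ (fderiv ℝ u) x (b i) (b j) := by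
      rw [Finset.sum_comm]
      conv_lhs => rw [← b.sum_repr' (fderiv ℝ (∇ u) x (∇ u x))]
      rw [map_sum]
      refine Finset.sum_congr rfl fun j _ => ?_
      rw [map_smul, real_inner_comm, fderiv_gradient_apply hu, fderiv_fderiv_symm hu,
        fderiv_apply_gradient_eq_sum b, smul_eq_mul, Finset.sum_mul]
      refine Finset.sum_congr rfl fun i _ => ?_
      rw [fderiv_fderiv_symm hu x (b i)]
      ring
    have e2 : ψ x * (Δ u x) ^ 2 + Δ u x * fderiv ℝ ψ x (∇ u x) =
        (∑ i, (ψ x * fderiv ℝ (fderiv ℝ u) x (b i) (b i) + fderiv ℝ ψ x (b i) * fderiv ℝ u x (b i)))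
         * ∑ j, fderiv ℝ (fderiv ℝ u) x (b j) (b j) := by
      rw [Finset.sum_add_distrib, ← Finset.mul_sum, ← laplacian_eq_sum_fderiv b,
        ← fderiv_apply_gradient_eq_sum b]
      ring
    rw [sub_sub, e2, e1, Finset.mul_sum, Finset.sum_mul, ← Finset.sum_add_distrib,
      ← Finset.sum_sub_distrib]
    refine Finset.sum_congr rfl fun i _ => ?_
    rw [Finset.mul_sum, Finset.mul_sum, ← Finset.sum_add_distrib, ← Finset.sum_sub_distrib]
    refine Finset.sum_congr rfl fun j _ => ?_
    simp only [dH, du]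
    rw [fderiv_fderiv_symm hu x (b j) (b i)]
    ring
  rw [key]
  have int' : ∀ i j, Integrable fun x =>
      fderiv ℝ (fun x => ψ x * fderiv ℝ u x (b i)) x (b j) *
        fderiv ℝ (fun x => fderiv ℝ u x (b j)) x (b i)
      - fderiv ℝ (fun x => ψ x * fderiv ℝ u x (b i)) x (b i) *
        fderiv ℝ (fun x => fderiv ℝ u x (b j)) x (b j) :=
    fun i j => (int i j (b j) (b i)).sub (int i j (b i) (b j))
  refine ⟨integrable_finsetSum _ fun i _ => integrable_finsetSum _ fun j _ => int' i j, ?_⟩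
  rw [integral_finsetSum _ fun i _ => integrable_finsetSum _ fun j _ => int' i j]
  refine Finset.sum_eq_zero fun i _ => ?_
  rw [integral_finsetSum _ fun j _ => int' i j]
  refine Finset.sum_eq_zero fun j _ => ?_
  rw [integral_sub (int i j _ _) (int i j _ _),
    integral_fderiv_mul_fderiv_comm (cH i) (cu j) (sH i), sub_self]

end Calculus

/-! ### Radial functions and the minimum principle -/

section Radial

variable {E : Type*} [NormedAddCommGroup E] [InnerProductSpace ℝ E] [FiniteDimensional ℝ E]

omit [FiniteDimensional ℝ E] in
theorem hasFDerivAt_comp_norm_sub_sq {G : ℝ → ℝ} {a : ℝ} {x z : E}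
    (h : HasDerivAt G a (‖x - z‖ ^ 2)) :
    HasFDerivAt (fun y => G (‖y - z‖ ^ 2)) ((2 * a) • innerSL ℝ (x - z)) x := by
  have h1 : HasFDerivAt (fun y : E => ‖y - z‖ ^ 2) _ x := ((hasFDerivAt_id x).sub_const z).norm_sq
  have h2 := h.comp_hasFDerivAt x h1
  refine h2.congr_fderiv ?_
  ext v
  simp
  ring

theorem gradient_comp_norm_sub_sq {G : ℝ → ℝ} {a : ℝ} {x z : E}
    (h : HasDerivAt G a (‖x - z‖ ^ 2)) :
    ∇ (fun y => G (‖y - z‖ ^ 2)) x = (2 * a) • (x - z) := by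
  refine ext_inner_right ℝ fun v => ?_
  rw [inner_gradient_left, (hasFDerivAt_comp_norm_sub_sq h).fderiv, inner_smul_left]
  simp [inner_sub_left]

theorem laplacian_comp_norm_sub_sq {G G' : ℝ → ℝ} {c : ℝ} {x z : E}
    (h : ∀ s, 0 ≤ s → HasDerivAt G (G' s) s) (h' : HasDerivAt G' c (‖x - z‖ ^ 2)) :
    Δ (fun y => G (‖y - z‖ ^ 2)) x
      = 4 * c * ‖x - z‖ ^ 2 + 2 * finrank ℝ E * G' (‖x - z‖ ^ 2) := by
  have h1 : fderiv ℝ (fun y : E => G (‖y - z‖ ^ 2))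
      = fun y => (2 * G' (‖y - z‖ ^ 2)) • innerSL ℝ (y - z) :=
    funext fun y => (hasFDerivAt_comp_norm_sub_sq (h _ (by positivity))).fderiv
  have h2 := (hasFDerivAt_comp_norm_sub_sq h').const_mul 2
  have h3 : HasFDerivAt (fun y : E => innerSL ℝ (y - z)) (innerSL ℝ) x :=
    (innerSL ℝ (E := E)).hasFDerivAt.comp x ((hasFDerivAt_id x).sub_const z)
  rw [laplacian_eq_sum_fderiv (stdOrthonormalBasis ℝ E), h1, (h2.fun_smul h3).fderiv]
  have h4 := (stdOrthonormalBasis ℝ E).sum_sq_norm_inner_right (x - z)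
  simp only [Real.norm_eq_abs, sq_abs] at h4
  simp [Finset.sum_add_distrib, -map_sub]
  rw [← h4, Finset.mul_sum]
  rw [add_comm]
  congr 1
  · refine Finset.sum_congr rfl fun i _ => ?_
    rw [real_inner_comm]
    ring
  · have : ∀ i, innerSL ℝ (stdOrthonormalBasis ℝ E i) (stdOrthonormalBasis ℝ E i) = (1 : ℝ) := by
      simp
    simp_rw [this]
    simp
    ring

/-- At a local minimum of a function of class `C²` the Laplacian is nonnegative. -/
theorem laplacian_nonneg_of_isLocalMin {w : E → ℝ} (hw : ContDiff ℝ 2 w) {x : E}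
    (hx : IsLocalMin w x) : 0 ≤ Δ w x := by
  rw [laplacian_eq_sum_fderiv (stdOrthonormalBasis ℝ E)]
  refine Finset.sum_nonneg fun i _ => ?_
  set e := stdOrthonormalBasis ℝ E i
  have hw1 : ContDiff ℝ 1 (fderiv ℝ w) := hw.fderiv_right (m := 1) (by norm_num)
  have hl : ∀ t : ℝ, HasDerivAt (fun t : ℝ => x + t • e) e t := fun t => by
    simpa using ((hasDerivAt_id t).smul_const e).const_add x
  have h1 : ∀ t : ℝ, HasDerivAt (fun t : ℝ => w (x + t • e)) (fderiv ℝ w (x + t • e) e) t :=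
    fun t =>
      (hw.differentiable two_ne_zero (x + t • e)).hasFDerivAt.comp_hasDerivAt t (hl t)
  have h2 : HasDerivAt (fun t : ℝ => fderiv ℝ w (x + t • e) e)
      (fderiv ℝ (fderiv ℝ w) x e e) 0 := by
    have h3 : HasDerivAt (fun t : ℝ => fderiv ℝ w (x + t • e)) (fderiv ℝ (fderiv ℝ w) x e) 0 :=
      (hw1.differentiable one_ne_zero x).hasFDerivAt.comp_hasDerivAt_of_eq 0 (hl 0) (by simp)
    have h4 := ((ContinuousLinearMap.apply ℝ ℝ e).hasFDerivAt
      (x := fderiv ℝ w (x + (0 : ℝ) • e))).comp_hasDerivAt (0 : ℝ) h3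
    exact h4
  have hd : deriv (fun t : ℝ => w (x + t • e)) = fun t => fderiv ℝ w (x + t • e) e :=
    funext fun t => (h1 t).deriv
  have hdd : deriv (deriv fun t : ℝ => w (x + t • e)) 0 = fderiv ℝ (fderiv ℝ w) x e e := by
    rw [hd, h2.deriv]
  have hmin : IsLocalMin (fun t : ℝ => w (x + t • e)) 0 := by
    have : Tendsto (fun t : ℝ => x + t • e) (𝓝 0) (𝓝 x) := by
      have := (hl 0).continuousAt.tendsto
      simpa using this
    have := this.eventually hx
    simpa [IsLocalMin, IsMinFilter] using this
  by_contra! hneg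
  have hmax : IsLocalMax (fun t : ℝ => w (x + t • e)) 0 :=
    isLocalMax_of_deriv_deriv_neg (by rwa [hdd]) hmin.deriv_eq_zero (h1 0).continuousAt
  have hconst : (fun t : ℝ => w (x + t • e)) =ᶠ[𝓝 0] fun _ => w (x + (0 : ℝ) • e) := by
    filter_upwards [hmin, hmax] with t ht1 ht2 using le_antisymm ht2 ht1
  have := hconst.deriv.deriv_eq
  rw [hdd] at this
  simp at this
  exact hneg.ne this

/-- The strong minimum principle in quantitative form: a nonnegative supersolution which is
positive at one point is bounded below by a power of the distance. The comparison function is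
`(1 + ‖x - z‖²)^(-m)` with `m` large. -/
theorem exists_rpow_le_of_supersolution {u : E → ℝ} (hu : ContDiff ℝ 2 u) (hnn : ∀ x, 0 ≤ u x)
    {β : ℝ} (hβ : 0 < β)
    (hsup : ∀ x, Δ u x - (1 / 2) * inner ℝ x (∇ u x) - β * u x ≤ 0) {z : E} (hz : 0 < u z) :
    ∃ δ > 0, ∃ m > 0, ∀ x, δ * (1 + ‖x - z‖ ^ 2) ^ (-m : ℝ) ≤ u x := by
  obtain ⟨r, hr, hball⟩ : ∃ r > 0, ∀ x, ‖x - z‖ < r → u z / 2 < u x := by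
    have : ∀ᶠ x in 𝓝 z, u z / 2 < u x :=
      hu.continuous.continuousAt.eventually (lt_mem_nhds (half_lt_self hz))
    obtain ⟨r, hr, h⟩ := Metric.eventually_nhds_iff.1 this
    exact ⟨r, hr, fun x hx => h (by rwa [dist_eq_norm])⟩
  set δ := u z / 2 with hδ
  have hδ0 : 0 < δ := half_pos hz
  set n : ℝ := (finrank ℝ E : ℝ)
  set κ : ℝ := r ^ 2 / (1 + r ^ 2) with hκ
  have hκ0 : 0 < κ := by positivity
  obtain ⟨m, hm0, hmβ, hmκ⟩ : ∃ m : ℝ, 0 < m ∧ 2 * β ≤ m ∧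
      2 * n + (1 + ‖z‖ ^ 2) / 2 < 4 * m * κ := by
    refine ⟨2 * β + (2 * n + (1 + ‖z‖ ^ 2) / 2) / (4 * κ), by positivity,
      le_add_of_nonneg_right (by positivity), ?_⟩
    have : 4 * (2 * β + (2 * n + (1 + ‖z‖ ^ 2) / 2) / (4 * κ)) * κ
      = 8 * β * κ + (2 * n + (1 + ‖z‖ ^ 2) / 2) := by field_simp; ring
    rw [this]
    have : 0 < 8 * β * κ := by positivity
    linarith
  refine ⟨δ, hδ0, m, hm0, ?_⟩
  set h : E → ℝ := fun x => (1 + ‖x - z‖ ^ 2) ^ (-m : ℝ) with hh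
  have hG : ∀ s : ℝ, 0 ≤ s → HasDerivAt (fun s : ℝ => (1 + s) ^ (-m : ℝ))
      (-m * (1 + s) ^ (-m - 1 : ℝ)) s := fun s hs => by
    have := ((hasDerivAt_id s).const_add 1).rpow_const (p := -m) (Or.inl (by simp; positivity))
    simpa using this
  have hG' : ∀ s : ℝ, 0 ≤ s → HasDerivAt (fun s : ℝ => -m * (1 + s) ^ (-m - 1 : ℝ))
      (m * (m + 1) * (1 + s) ^ (-m - 2 : ℝ)) s := fun s hs => by
    have := (((hasDerivAt_id s).const_add 1).rpow_const (p := -m - 1)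
      (Or.inl (by simp; positivity))).const_mul (-m)
    refine this.congr_deriv ?_
    simp
    ring_nf
  have hhC : ContDiff ℝ 2 h := by
    refine ContDiff.rpow_const_of_ne ?_ fun x => by positivity
    exact contDiff_const.add ((contDiff_id.sub contDiff_const).norm_sq ℝ)
  have hpos : ∀ x, 0 < h x := fun x => by simp only [hh]; positivity
  have hle1 : ∀ x, h x ≤ 1 := fun x =>
    Real.rpow_le_one_of_one_le_of_nonpos (by simp) (by linarith)
  -- the comparison function is a strict subsolution away from `z`
  have hsub : ∀ x, r ≤ ‖x - z‖ → 0 < Δ h x - (1 / 2) * inner ℝ x (∇ h x) - β * h x := by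
    intro x hx
    have eΔ := laplacian_comp_norm_sub_sq (x := x) (z := z) hG (hG' _ (sq_nonneg ‖x - z‖))
    have eg := gradient_comp_norm_sub_sq (x := x) (z := z) (hG _ (sq_nonneg ‖x - z‖))
    rw [hh, eΔ, eg, inner_smul_right, ← hh]
    set d := ‖x - z‖ with hd
    have hS : 0 < 1 + d ^ 2 := by positivity
    have e1 : (1 + d ^ 2) ^ (-m - 1 : ℝ) = h x / (1 + d ^ 2) := by
      rw [Real.rpow_sub hS, Real.rpow_one]
    have e2 : (1 + d ^ 2) ^ (-m - 2 : ℝ) = h x / (1 + d ^ 2) ^ 2 := by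
      rw [Real.rpow_sub hS]; norm_num [hh, hd]
    rw [e1, e2]
    have hin : d ^ 2 / 2 - ‖z‖ ^ 2 / 2 ≤ inner ℝ x (x - z) := by
      have e : inner ℝ x (x - z) = d ^ 2 + inner ℝ z (x - z) := by
        rw [hd, ← real_inner_self_eq_norm_sq, ← inner_add_left]; simp
      have := neg_le_of_abs_le (abs_real_inner_le_norm z (x - z))
      nlinarith [sq_nonneg (d - ‖z‖)]
    have hκd : κ * (1 + d ^ 2) ≤ d ^ 2 := by
      rw [hκ, div_mul_eq_mul_div, div_le_iff₀ (by positivity)]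
      have : r ^ 2 ≤ d ^ 2 := by gcongr
      nlinarith
    have key : 0 < 4 * m * (m + 1) * d ^ 2 / (1 + d ^ 2) - 2 * m * n + m * inner ℝ x (x - z)
        - β * (1 + d ^ 2) := by
      have t1 : 4 * m * (m + 1) * κ ≤ 4 * m * (m + 1) * d ^ 2 / (1 + d ^ 2) := by
        rw [le_div_iff₀ hS, mul_assoc]
        gcongr
      have t2 := mul_le_mul_of_nonneg_left hin hm0.le
      have t3 := mul_lt_mul_of_pos_left hmκ hm0
      have t4 := mul_le_mul_of_nonneg_right hmβ hS.le
      have t5 : 0 < m * κ := by positivity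
      nlinarith
    have : 4 * (m * (m + 1) * (h x / (1 + d ^ 2) ^ 2)) * d ^ 2 +
        2 * n * (-m * (h x / (1 + d ^ 2))) -
        1 / 2 * (2 * (-m * (h x / (1 + d ^ 2))) * inner ℝ x (x - z)) - β * h x
        = h x / (1 + d ^ 2) * (4 * m * (m + 1) * d ^ 2 / (1 + d ^ 2) - 2 * m * n
          + m * inner ℝ x (x - z) - β * (1 + d ^ 2)) := by
      field_simp
      ring
    rw [this]
    exact mul_pos (div_pos (hpos x) hS) key
  by_contra! hcon
  obtain ⟨x₁, hx₁⟩ := hcon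
  set w : E → ℝ := fun x => u x - δ * h x with hw
  have hwC : ContDiff ℝ 2 w := hu.sub (contDiff_const.mul hhC)
  have hx₁' : w x₁ < 0 := by simp only [hw]; linarith
  -- outside of a large ball the comparison function is below the negative level of `w`
  obtain ⟨R, hR1, hRh⟩ : ∃ R, ‖x₁ - z‖ ≤ R ∧ ∀ x, ‖x - z‖ = R → δ * h x < -w x₁ := by
    have hlim : Tendsto (fun R : ℝ => δ * (1 + R ^ 2) ^ (-m : ℝ)) atTop (𝓝 (δ * 0)) := by
      refine Tendsto.const_mul δ ((tendsto_rpow_neg_atTop hm0).comp ?_)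
      exact tendsto_atTop_add_const_left _ _ (tendsto_pow_atTop two_ne_zero)
    rw [mul_zero] at hlim
    obtain ⟨R, hR, hR'⟩ := ((hlim.eventually (gt_mem_nhds (neg_pos.2 hx₁'))).and
      (eventually_ge_atTop ‖x₁ - z‖)).exists
    exact ⟨R, hR', fun x hx => by simpa only [hh, hx] using hR⟩
  obtain ⟨x₀, hx₀, hmin⟩ := (isCompact_closedBall z R).exists_isMinOn
    ⟨x₁, by simpa [dist_eq_norm] using hR1⟩ hwC.continuous.continuousOn
  have hw₀ : w x₀ ≤ w x₁ := hmin (by simpa [dist_eq_norm] using hR1)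
  have hx₀R : ‖x₀ - z‖ < R := by
    refine lt_of_le_of_ne (by simpa [dist_eq_norm] using hx₀) fun he => ?_
    have := hRh x₀ he
    have := hnn x₀
    simp only [hw] at hw₀ hx₁' this
    linarith
  have hx₀r : r ≤ ‖x₀ - z‖ := by
    by_contra! hlt
    have h1 := hball x₀ hlt
    have h2 := mul_le_mul_of_nonneg_left (hle1 x₀) hδ0.le
    simp only [hw] at hw₀ hx₁'
    linarith
  have hloc : IsLocalMin w x₀ := hmin.isLocalMin <|
    mem_of_superset (Metric.isOpen_ball.mem_nhds (by simpa [dist_eq_norm] using hx₀R))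
      Metric.ball_subset_closedBall
  have hL := laplacian_nonneg_of_isLocalMin hwC hloc
  have hg : ∇ w x₀ = 0 := by simp [gradient, hloc.fderiv_eq_zero]
  have hgw : ∇ w x₀ = ∇ u x₀ - δ • ∇ h x₀ := by
    simp only [gradient, hw]
    rw [fderiv_fun_sub (hu.differentiable two_ne_zero x₀)
      ((hhC.differentiable two_ne_zero x₀).const_mul δ),
      fderiv_const_mul (hhC.differentiable two_ne_zero x₀)]
    simp
  have hLw : Δ w x₀ = Δ u x₀ - δ * Δ h x₀ := by
    have hs : ContDiffAt ℝ 2 (δ • h) x₀ := (contDiff_const.smul hhC).contDiffAt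
    have := hu.contDiffAt.laplacian_sub (x := x₀) hs
    rw [laplacian_smul δ hhC.contDiffAt] at this
    exact this
  have h1 := hsup x₀
  have h2 := mul_pos hδ0 (hsub x₀ hx₀r)
  have h3 : inner ℝ x₀ (∇ u x₀) = δ * inner ℝ x₀ (∇ h x₀) := by
    rw [sub_eq_zero.1 (hgw.symm.trans hg), inner_smul_right]
  have h4 : β * w x₀ < 0 := mul_neg_of_pos_of_neg hβ (hw₀.trans_lt hx₁')
  simp only [hw] at h4
  rw [h3] at h1
  nlinarith

end Radial

/-! ### The Gidas–Spruck integral inequality -/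

section GidasSpruck

variable {E : Type*} [NormedAddCommGroup E] [InnerProductSpace ℝ E] [FiniteDimensional ℝ E]

/-- Nonnegativity of the trace-free part of the symmetric matrix `D²u + c ∇u ⊗ ∇u`. -/
theorem sq_laplacian_add_le_hessian {ι : Type*} [Fintype ι] (b : OrthonormalBasis ι ℝ E)
    (u : E → ℝ) (x : E) (c : ℝ) :
    (Δ u x + c * ‖∇ u x‖ ^ 2) ^ 2 ≤ Fintype.card ι *
      (∑ i, ∑ j, (fderiv ℝ (fderiv ℝ u) x (b i) (b j)) ^ 2
        + 2 * c * fderiv ℝ (fderiv ℝ u) x (∇ u x) (∇ u x) + c ^ 2 * (‖∇ u x‖ ^ 2) ^ 2) := by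
  set g : ι → ℝ := fun i => fderiv ℝ u x (b i) with hg
  set H : ι → ι → ℝ := fun i j => fderiv ℝ (fderiv ℝ u) x (b i) (b j) with hH
  have e1 : ‖∇ u x‖ ^ 2 = ∑ i, g i * g i := by
    rw [← fderiv_apply_gradient_self, fderiv_apply_gradient_eq_sum b]
  have e2 : Δ u x = ∑ i, H i i := laplacian_eq_sum_fderiv b u x
  have e3 : fderiv ℝ (fderiv ℝ u) x (∇ u x) (∇ u x) = ∑ i, ∑ j, g i * g j * H i j := by
    have h : ∀ y, fderiv ℝ (fderiv ℝ u) x (∇ u x) y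
        = ∑ i, g i * fderiv ℝ (fderiv ℝ u) x (b i) y := fun y => by
      conv_lhs => rw [← b.sum_repr' (∇ u x)]
      simp [hg, inner_gradient_right]
    rw [h]
    refine Finset.sum_congr rfl fun i _ => ?_
    rw [fderiv_apply_gradient_eq_sum b, Finset.mul_sum]
    exact Finset.sum_congr rfl fun j _ => by simp only [hg, hH]; ring
  have e4 : ∑ i, ∑ j, H i j ^ 2 + 2 * c * ∑ i, ∑ j, g i * g j * H i j
      + c ^ 2 * (∑ i, g i * g i) ^ 2 = ∑ i, ∑ j, (H i j + c * (g i * g j)) ^ 2 := by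
    rw [sq (∑ i, g i * g i), Finset.sum_mul_sum, Finset.mul_sum, Finset.mul_sum,
      ← Finset.sum_add_distrib, ← Finset.sum_add_distrib]
    refine Finset.sum_congr rfl fun i _ => ?_
    rw [Finset.mul_sum, Finset.mul_sum, ← Finset.sum_add_distrib, ← Finset.sum_add_distrib]
    exact Finset.sum_congr rfl fun j _ => by ring
  have e5 : Δ u x + c * ‖∇ u x‖ ^ 2 = ∑ i, (H i i + c * (g i * g i)) := by
    rw [e1, e2, Finset.sum_add_distrib, Finset.mul_sum]
  rw [e5, e1, e3, e4]
  refine sq_sum_le_card_mul_sum_sq.trans ?_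
  rw [Finset.card_univ]
  gcongr with i _
  exact Finset.single_le_sum (f := fun j => (H i j + c * (g i * g j)) ^ 2)
    (fun j _ => sq_nonneg _) (Finset.mem_univ i)

omit [FiniteDimensional ℝ E] in
theorem fderiv_rpow_const_apply {u : E → ℝ} (hu : ContDiff ℝ 2 u) (hpos : ∀ x, 0 < u x)
    (r : ℝ) (x v : E) :
    fderiv ℝ (fun x => u x ^ r) x v = r * u x ^ (r - 1) * fderiv ℝ u x v := by
  rw [((hu.differentiable two_ne_zero x).hasFDerivAt.rpow_const (p := r)
    (Or.inl (hpos x).ne')).fderiv]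
  simp

omit [FiniteDimensional ℝ E] in
theorem fderiv_mul_apply_of_contDiff {f g : E → ℝ} (hf : ContDiff ℝ 1 f) (hg : ContDiff ℝ 1 g)
    (x v : E) :
    fderiv ℝ (fun x => f x * g x) x v = f x * fderiv ℝ g x v + g x * fderiv ℝ f x v := by
  rw [fderiv_fun_mul (hf.differentiable one_ne_zero x) (hg.differentiable one_ne_zero x)]
  simp

variable [MeasurableSpace E] [BorelSpace E]

/-- Green's identity for `φ uʳ ∇u`. -/
theorem integral_green_rpow {u φ : E → ℝ} (hu : ContDiff ℝ 2 u) (hpos : ∀ x, 0 < u x)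
    (hφ : ContDiff ℝ 2 φ) (hc : HasCompactSupport φ) (r : ℝ) :
    Integrable (fun x => φ x * u x ^ r * Δ u x + u x ^ r * fderiv ℝ φ x (∇ u x)
      + r * φ x * u x ^ (r - 1) * ‖∇ u x‖ ^ 2) ∧
    ∫ x, (φ x * u x ^ r * Δ u x + u x ^ r * fderiv ℝ φ x (∇ u x)
      + r * φ x * u x ^ (r - 1) * ‖∇ u x‖ ^ 2) = 0 := by
  have hr : ContDiff ℝ 2 fun x => u x ^ r := hu.rpow_const_of_ne fun x => (hpos x).ne'
  have hψ : ContDiff ℝ 1 fun x => φ x * u x ^ r := (hφ.mul hr).of_le (by norm_num)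
  have key := integral_mul_laplacian_add_fderiv_gradient hψ hu (Or.inl hc.mul_right)
  convert key using 3
  all_goals
    try funext x
    rw [fderiv_mul_apply_of_contDiff (hφ.of_le (by norm_num)) (hr.of_le (by norm_num)),
      fderiv_rpow_const_apply hu hpos, fderiv_apply_gradient_self]
    ring

theorem integral_nonneg_of_add_null {X : Type*} [MeasurableSpace X] {μ : Measure X}
    {T W A B C : X → ℝ} (hW : Integrable W μ)
    (hW0 : ∀ x, 0 ≤ W x) (hA : Integrable A μ ∧ ∫ x, A x ∂μ = 0)
    (hB : Integrable B μ ∧ ∫ x, B x ∂μ = 0) (hC : Integrable C μ ∧ ∫ x, C x ∂μ = 0) (c d : ℝ)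
    (hT : ∀ x, T x = W x - A x + c * B x - d * C x) :
    Integrable T μ ∧ 0 ≤ ∫ x, T x ∂μ := by
  have hWA : Integrable (fun x => W x - A x) μ := hW.sub hA.1
  have hWAB : Integrable (fun x => W x - A x + c * B x) μ := hWA.add (hB.1.const_mul c)
  rw [funext hT]
  refine ⟨hWAB.sub (hC.1.const_mul d), ?_⟩
  rw [integral_sub hWAB (hC.1.const_mul d), integral_add hWA (hB.1.const_mul c),
    integral_sub hW hA.1, integral_const_mul, integral_const_mul, hA.2, hB.2, hC.2]
  simpa using integral_nonneg hW0

/-- The Gidas–Spruck integral inequality. It is the integral of the trace-free inequality for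
`D²u + k u⁻¹ ∇u ⊗ ∇u` against `φ u^q`, after the second derivatives of `u` other than `Δu` have been
removed by integrations by parts. -/
theorem gidas_spruck_integral_nonneg [Nontrivial E] {u φ : E → ℝ} (hu : ContDiff ℝ 2 u)
    (hpos : ∀ x, 0 < u x) (hφ : ContDiff ℝ 2 φ) (hc : HasCompactSupport φ) (hφ0 : ∀ x, 0 ≤ φ x)
    {n : ℝ} (hn : n = finrank ℝ E) (q k : ℝ) :
    Integrable (fun x =>
      ((n - 1) / n * k ^ 2 - (q - 1) * k + q * (q - 1) / 2)
          * (φ x * u x ^ (q - 2) * (‖∇ u x‖ ^ 2) ^ 2)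
        - ((n + 2) / n * k - 3 * q / 2) * (φ x * u x ^ (q - 1) * ‖∇ u x‖ ^ 2 * Δ u x)
        + (n - 1) / n * (φ x * u x ^ q * Δ u x ^ 2)
        + u x ^ q * Δ u x * fderiv ℝ φ x (∇ u x)
        + (q - k) * (u x ^ (q - 1) * ‖∇ u x‖ ^ 2 * fderiv ℝ φ x (∇ u x))
        + 1 / 2 * (u x ^ q * ‖∇ u x‖ ^ 2 * Δ φ x)) ∧
    0 ≤ ∫ x, (
      ((n - 1) / n * k ^ 2 - (q - 1) * k + q * (q - 1) / 2)
          * (φ x * u x ^ (q - 2) * (‖∇ u x‖ ^ 2) ^ 2)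
        - ((n + 2) / n * k - 3 * q / 2) * (φ x * u x ^ (q - 1) * ‖∇ u x‖ ^ 2 * Δ u x)
        + (n - 1) / n * (φ x * u x ^ q * Δ u x ^ 2)
        + u x ^ q * Δ u x * fderiv ℝ φ x (∇ u x)
        + (q - k) * (u x ^ (q - 1) * ‖∇ u x‖ ^ 2 * fderiv ℝ φ x (∇ u x))
        + 1 / 2 * (u x ^ q * ‖∇ u x‖ ^ 2 * Δ φ x)) := by
  set b := stdOrthonormalBasis ℝ E
  have hn0 : 0 < n := by rw [hn]; exact_mod_cast finrank_pos
  have hr : ∀ r : ℝ, ContDiff ℝ 1 fun x => u x ^ r := fun r =>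
    (hu.rpow_const_of_ne fun x => (hpos x).ne').of_le (by norm_num)
  have hφ1 : ContDiff ℝ 1 φ := hφ.of_le (by norm_num)
  have hg1 : ContDiff ℝ 1 fun x => ‖∇ u x‖ ^ 2 := (contDiff_gradient hu).norm_sq ℝ
  have hD : Continuous (fderiv ℝ (fderiv ℝ u)) :=
    (hu.fderiv_right (m := 1) (by norm_num)).continuous_fderiv one_ne_zero
  set S : E → ℝ := fun x => ∑ i, ∑ j, (fderiv ℝ (fderiv ℝ u) x (b i) (b j)) ^ 2 with hS
  set Q : E → ℝ := fun x => fderiv ℝ (fderiv ℝ u) x (∇ u x) (∇ u x) with hQ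
  set P : E → ℝ := fun x => fderiv ℝ (fderiv ℝ u) x (∇ u x) (∇ φ x) with hP
  -- the pointwise inequality
  set W : E → ℝ := fun x => φ x * (u x ^ q * (S x + 2 * (k / u x) * Q x
    + (k / u x) ^ 2 * (‖∇ u x‖ ^ 2) ^ 2 - (Δ u x + k / u x * ‖∇ u x‖ ^ 2) ^ 2 / n)) with hW
  have hW0 : ∀ x, 0 ≤ W x := fun x => by
    refine mul_nonneg (hφ0 x) (mul_nonneg (Real.rpow_nonneg (hpos x).le q) ?_)
    have := sq_laplacian_add_le_hessian b u x (k / u x)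
    rw [Fintype.card_fin, ← hn] at this
    rw [sub_nonneg, div_le_iff₀' hn0]
    exact this
  have hWint : Integrable W := by
    refine Continuous.integrable_of_hasCompactSupport ?_ hc.mul_right
    have c1 := continuous_laplacian hu
    have c2 := (contDiff_gradient hu).continuous
    have c3 := hu.continuous
    have c4 := hφ.continuous
    have c5 := (hr q).continuous
    have c6 : Continuous fun x => k / u x := continuous_const.div c3 fun x => (hpos x).ne'
    have c7 : Continuous S := by fun_prop
    have c8 : Continuous Q := by fun_prop
    fun_prop
  -- the weak Bochner formula against `φ u^q`
  have A := integral_hessian_sq_sub_laplacian_sq b (ψ := fun x => φ x * u x ^ q) hu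
    (hφ1.mul (hr q)) hc.mul_right
  -- Green's identities for `|∇u|² u^q ∇φ` and `φ u^(q-1) |∇u|² ∇u`
  have B := integral_mul_laplacian_add_fderiv_gradient
    (ψ := fun x => u x ^ q * ‖∇ u x‖ ^ 2) ((hr q).mul hg1) hφ (Or.inr hc)
  have C := integral_mul_laplacian_add_fderiv_gradient
    (ψ := fun x => φ x * (u x ^ (q - 1) * ‖∇ u x‖ ^ 2)) (hφ1.mul ((hr (q - 1)).mul hg1)) hu
    (Or.inl hc.mul_right)
  have dA : ∀ x v, fderiv ℝ (fun x => φ x * u x ^ q) x v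
      = φ x * (q * u x ^ (q - 1) * fderiv ℝ u x v) + u x ^ q * fderiv ℝ φ x v := fun x v => by
    rw [fderiv_mul_apply_of_contDiff hφ1 (hr q), fderiv_rpow_const_apply hu hpos]
  have dB : ∀ r x v, fderiv ℝ (fun x => u x ^ r * ‖∇ u x‖ ^ 2) x v
      = u x ^ r * (2 * fderiv ℝ (fderiv ℝ u) x v (∇ u x))
        + ‖∇ u x‖ ^ 2 * (r * u x ^ (r - 1) * fderiv ℝ u x v) := fun r x v => by
    rw [fderiv_mul_apply_of_contDiff (hr r) hg1, fderiv_rpow_const_apply hu hpos,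
      fderiv_norm_sq_gradient hu]
  have dC : ∀ x v, fderiv ℝ (fun x => φ x * (u x ^ (q - 1) * ‖∇ u x‖ ^ 2)) x v
      = φ x * fderiv ℝ (fun x => u x ^ (q - 1) * ‖∇ u x‖ ^ 2) x v
        + (u x ^ (q - 1) * ‖∇ u x‖ ^ 2) * fderiv ℝ φ x v := fun x v => by
    rw [fderiv_mul_apply_of_contDiff hφ1 ((hr (q - 1)).mul hg1)]
  have eQ : ∀ x, fderiv ℝ u x (fderiv ℝ (∇ u) x (∇ u x)) = Q x := fun x => by
    rw [← inner_gradient_left, real_inner_comm, fderiv_gradient_apply hu]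
  have eP : ∀ x, fderiv ℝ φ x (fderiv ℝ (∇ u) x (∇ u x)) = P x := fun x => by
    rw [← inner_gradient_left, real_inner_comm, fderiv_gradient_apply hu]
  have eP' : ∀ x, fderiv ℝ (fderiv ℝ u) x (∇ φ x) (∇ u x) = P x := fun x =>
    fderiv_fderiv_symm hu x _ _
  have eq2 : ∀ x, u x ^ (q - 1 - 1) = u x ^ (q - 2) := fun x => by ring_nf
  simp only [dA, dB, dC, eQ, eP, eP', fderiv_apply_gradient_self, eq2,
    fderiv_apply_gradient_comm u φ] at A B C
  refine integral_nonneg_of_add_null hWint hW0 A B C (1 / 2) (k - q / 2) fun x => ?_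
  have h1 : u x ^ (q - 1) = u x ^ q / u x := by
    rw [Real.rpow_sub (hpos x), Real.rpow_one]
  have h2 : u x ^ (q - 2) = u x ^ q / u x ^ 2 := by
    rw [Real.rpow_sub (hpos x)]; norm_num
  simp only [hW, hS, hQ, hP]
  rw [h1, h2]
  have := (hpos x).ne'
  have := hn0.ne'
  field_simp
  ring

end GidasSpruck

/-! ### Choice of exponents and absorption of lower order terms -/

section Constants

/-- The coefficients of the Gidas–Spruck inequality. With `q = (1 - p) / 2` a suitable `k` exists
because `p` is subcritical: for `μ = 0` the quadratic expression is `(n - 1) / (16 n (n + 2)²)`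
times `((n - 2) p - (n + 2)) ((17 n - 2) p - (n + 2))`, so for `n > 1` it is negative. -/
theorem exists_gidas_spruck_coefficients {n p q : ℝ} (hn : 1 ≤ n) (hp : 1 < p)
    (hsub : (n - 2) * p < n + 2) (hq : q = (1 - p) / 2) :
    ∃ k μ : ℝ, 0 < μ ∧ (n - 1) / n * k ^ 2 - (q - 1) * k + q * (q - 1) / 2 < 0 ∧
      3 * q / 2 - (n + 2) / n * k = ((n - 1) / n + μ) * (q + p) := by
  have hn0 : 0 < n := by linarith
  -- the value of `k` determined by the linear relation with `μ = 0`; lowering it makes `μ` positive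
  set k₀ : ℝ := q / 2 - (n - 1) * p / (n + 2) with hk₀
  set f : ℝ → ℝ := fun d => (n - 1) / n * (k₀ - d) ^ 2 - (q - 1) * (k₀ - d) + q * (q - 1) / 2
    with hf
  have hfd : ∃ d : ℝ, f d < 0 ∧ 0 < d := by
    rcases hn.eq_or_lt with h1 | h1
    · -- in dimension one the quadratic vanishes at `k₀`, and a definite step is needed
      refine ⟨1, ?_, one_pos⟩
      have e : f 1 = q - 1 := by simp only [hf, hk₀, ← h1]; ring
      rw [e, hq]
      linarith
    · have e : f 0 = (n - 1) / (16 * n * (n + 2) ^ 2) *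
          (((n - 2) * p - (n + 2)) * ((17 * n - 2) * p - (n + 2))) := by
        simp only [hf, hk₀, hq]
        field_simp
        ring
      have f0 : f 0 < 0 := by
        rw [e]
        refine mul_neg_of_pos_of_neg (div_pos (by linarith) (by positivity))
          (mul_neg_of_neg_of_pos (by linarith) ?_)
        nlinarith
      have hc : Continuous f := by fun_prop
      exact (((hc.tendsto 0).eventually (gt_mem_nhds f0)).filter_mono
        nhdsWithin_le_nhds |>.and (self_mem_nhdsWithin (s := Ioi (0 : ℝ)))).exists
  obtain ⟨d, hd, hd0⟩ := hfd
  have hqp : 0 < q + p := by rw [hq]; linarith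
  refine ⟨k₀ - d, (n + 2) * d / (n * (q + p)), ?_, hd, ?_⟩
  · positivity
  · have e : (n + 2) * d / (n * (q + p)) * (q + p) = (n + 2) * d / n := by
      field_simp
    rw [add_mul, e, hk₀]
    field_simp
    ring

theorem exists_cubic_le_quartic {α D : ℝ} (hα : 0 < α) (hD : 0 ≤ D) :
    ∃ K, ∀ t, 0 ≤ t → D * (1 + t) ^ 3 ≤ α * t ^ 4 + K := by
  refine ⟨D * (1 + max 1 (8 * D / α)) ^ 3, fun t ht => ?_⟩
  rcases le_total t (max 1 (8 * D / α)) with h | h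
  · have : D * (1 + t) ^ 3 ≤ D * (1 + max 1 (8 * D / α)) ^ 3 := by gcongr
    have : 0 ≤ α * t ^ 4 := by positivity
    linarith
  · have h1 : 1 ≤ t := (le_max_left _ _).trans h
    have h2 : 8 * D ≤ α * t := (div_le_iff₀' hα).1 ((le_max_right _ _).trans h)
    have h3 : D * (1 + t) ^ 3 ≤ D * (t + t) ^ 3 := by gcongr
    have h4 : 8 * D * t ^ 3 ≤ α * t * t ^ 3 := by gcongr
    have h5 : 0 ≤ D * (1 + max 1 (8 * D / α)) ^ 3 := by positivity
    nlinarith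

/-- Absorption of all lower order terms by Young's inequality. Giving `t`, `l` the weights one,
and `z`, `g`, `d` the weights two, all terms have weight four once powers of the scale `l` are
supplied. -/
theorem exists_absorb_lower_order {α μ : ℝ} (hα : 0 < α) (hμ : 0 < μ) (c₁ c₂ c₃ c₄ c₅ c₆ c₇ : ℝ)
    {B : ℝ} (hB : 1 ≤ B) :
    ∃ K, 0 < K ∧ ∀ t z l g d e : ℝ, 0 ≤ t → 0 ≤ z → 1 ≤ l → |g| ≤ B * (l ^ 2 + l * t) →
      |d| ≤ B * (l * t) → |e| ≤ B * l ^ 2 →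
      -α * t ^ 4 - μ * z ^ 2 + c₁ * (t ^ 2 * g) + c₂ * (g * g) + c₃ * (z * g) + c₄ * (g * d)
        + c₅ * (z * d) + c₆ * (t ^ 2 * d) + c₇ * (t ^ 2 * e)
        ≤ -(α / 2) * t ^ 4 - μ / 2 * z ^ 2 + K * l ^ 4 := by
  set c := |c₁| + |c₂| + |c₃| + |c₄| + |c₅| + |c₆| + |c₇| with hc
  have hc0 : 0 ≤ c := by positivity
  set M := c * B ^ 2 with hM
  have hM0 : 0 ≤ M := by positivity
  obtain ⟨K, hK⟩ := exists_cubic_le_quartic (half_pos hα)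
    (show 0 ≤ 2 * M + M ^ 2 / (2 * μ) by positivity)
  refine ⟨max K 1, by positivity, fun t z l g d e ht hz hl hg hd he => ?_⟩
  have hl0 : 0 < l := by linarith
  obtain ⟨τ, rfl⟩ : ∃ τ, t = l * τ := ⟨t / l, by field_simp⟩
  obtain ⟨ζ, rfl⟩ : ∃ ζ, z = l ^ 2 * ζ := ⟨z / l ^ 2, by field_simp⟩
  have hτ : 0 ≤ τ := nonneg_of_mul_nonneg_right ht hl0
  have hζ : 0 ≤ ζ := nonneg_of_mul_nonneg_right hz (by positivity)
  have hg' : |g| ≤ B * l ^ 2 * (1 + τ) := hg.trans (le_of_eq (by ring))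
  have hd' : |d| ≤ B * l ^ 2 * (1 + τ) := hd.trans (by
    rw [show B * (l * (l * τ)) = B * l ^ 2 * τ by ring]; gcongr; linarith)
  have term : ∀ (a y Y : ℝ), |y| ≤ Y → a * y ≤ |a| * Y := fun a y Y h =>
    (le_abs_self _).trans (by rw [abs_mul]; gcongr)
  have hBB : B ≤ B ^ 2 := by nlinarith
  -- each of the seven terms is at most its coefficient times the same quantity `Y`
  set Y := B ^ 2 * l ^ 4 * (τ ^ 2 * (1 + τ) + (1 + τ) ^ 2 + ζ * (1 + τ)) with hY
  have p1 : 0 ≤ B ^ 2 * l ^ 4 * (τ ^ 2 * (1 + τ)) := by positivity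
  have p2 : 0 ≤ B ^ 2 * l ^ 4 * (1 + τ) ^ 2 := by positivity
  have p3 : 0 ≤ B ^ 2 * l ^ 4 * (ζ * (1 + τ)) := by positivity
  have hsplit : Y = B ^ 2 * l ^ 4 * (τ ^ 2 * (1 + τ)) + B ^ 2 * l ^ 4 * (1 + τ) ^ 2
    + B ^ 2 * l ^ 4 * (ζ * (1 + τ)) := by rw [hY]; ring
  have b1 : ∀ y, |y| ≤ B * l ^ 2 * (1 + τ) → |(l * τ) ^ 2 * y| ≤ Y := fun y hy => by
    rw [abs_mul, abs_of_nonneg (by positivity : 0 ≤ (l * τ) ^ 2)]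
    calc (l * τ) ^ 2 * |y| ≤ (l * τ) ^ 2 * (B * l ^ 2 * (1 + τ)) := by gcongr
      _ = B * (l ^ 4 * (τ ^ 2 * (1 + τ))) := by ring
      _ ≤ B ^ 2 * (l ^ 4 * (τ ^ 2 * (1 + τ))) := by gcongr
      _ ≤ Y := by linarith
  have b2 : ∀ y y', |y| ≤ B * l ^ 2 * (1 + τ) → |y'| ≤ B * l ^ 2 * (1 + τ) → |y * y'| ≤ Y :=
    fun y y' hy hy' => by
    rw [abs_mul]
    calc |y| * |y'| ≤ (B * l ^ 2 * (1 + τ)) * (B * l ^ 2 * (1 + τ)) := by gcongr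
      _ = B ^ 2 * l ^ 4 * (1 + τ) ^ 2 := by ring
      _ ≤ Y := by linarith
  have b3 : ∀ y, |y| ≤ B * l ^ 2 * (1 + τ) → |l ^ 2 * ζ * y| ≤ Y := fun y hy => by
    rw [abs_mul, abs_of_nonneg hz]
    calc l ^ 2 * ζ * |y| ≤ l ^ 2 * ζ * (B * l ^ 2 * (1 + τ)) := by gcongr
      _ = B * (l ^ 4 * (ζ * (1 + τ))) := by ring
      _ ≤ B ^ 2 * (l ^ 4 * (ζ * (1 + τ))) := by gcongr
      _ ≤ Y := by linarith
  have he' : |e| ≤ B * l ^ 2 * (1 + τ) := he.trans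
    (le_mul_of_one_le_right (by positivity) (by linarith))
  have s1 := term c₁ _ _ (b1 g hg')
  have s2 := term c₂ _ _ (b2 g g hg' hg')
  have s3 := term c₃ _ _ (b3 g hg')
  have s4 := term c₄ _ _ (b2 g d hg' hd')
  have s5 := term c₅ _ _ (b3 d hd')
  have s6 := term c₆ _ _ (b1 d hd')
  have s7 := term c₇ _ _ (b1 e he')
  have hsum : |c₁| * Y + |c₂| * Y + |c₃| * Y + |c₄| * Y + |c₅| * Y + |c₆| * Y + |c₇| * Y
      = l ^ 4 * (M * (τ ^ 2 * (1 + τ) + (1 + τ) ^ 2 + ζ * (1 + τ))) := by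
    rw [hM, hY, hc]; ring
  have young : M * (ζ * (1 + τ)) ≤ μ / 2 * ζ ^ 2 + M ^ 2 / (2 * μ) * (1 + τ) ^ 2 := by
    have : μ / 2 * ζ ^ 2 + M ^ 2 / (2 * μ) * (1 + τ) ^ 2 - M * (ζ * (1 + τ))
      = (μ * ζ - M * (1 + τ)) ^ 2 / (2 * μ) := by field_simp; ring
    have h2 : 0 ≤ (μ * ζ - M * (1 + τ)) ^ 2 / (2 * μ) := by positivity
    linarith
  have cubic : M * (τ ^ 2 * (1 + τ)) + M * (1 + τ) ^ 2 + M ^ 2 / (2 * μ) * (1 + τ) ^ 2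
      ≤ (2 * M + M ^ 2 / (2 * μ)) * (1 + τ) ^ 3 := by
    have h1 : (1 + τ) ^ 2 ≤ (1 + τ) ^ 3 := pow_le_pow_right₀ (by linarith) (by norm_num)
    have h2 : τ ^ 2 * (1 + τ) ≤ (1 + τ) ^ 3 := by
      rw [pow_succ (1 + τ) 2]; gcongr; linarith
    have h3 := mul_le_mul_of_nonneg_left h2 hM0
    have h4 := mul_le_mul_of_nonneg_left h1 hM0
    have h5 := mul_le_mul_of_nonneg_left h1 (show 0 ≤ M ^ 2 / (2 * μ) by positivity)
    rw [add_mul, two_mul M, add_mul]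
    exact add_le_add (add_le_add h3 h4) h5
  have hKτ := hK τ hτ
  have main : M * (τ ^ 2 * (1 + τ) + (1 + τ) ^ 2 + ζ * (1 + τ))
      ≤ μ / 2 * ζ ^ 2 + α / 2 * τ ^ 4 + max K 1 := by
    have := le_max_left K 1
    linarith
  have main' := mul_le_mul_of_nonneg_left main (show 0 ≤ l ^ 4 by positivity)
  linarith

end Constants

/-! ### Cutoff functions -/

section Cutoff

/-- A profile for cutoff functions: powers of a smooth step, whose derivatives are controlled by
lower powers of the same step. -/
theorem exists_cutoff_profile {m : ℕ} (hm : 3 ≤ m) :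
    ∃ C : ℝ, 0 ≤ C ∧ ∃ χ F₁ F₂ : ℝ → ℝ, ContDiff ℝ 2 (fun s => χ s ^ m) ∧
      (∀ s, HasDerivAt (fun s => χ s ^ m) (F₁ s) s) ∧ (∀ s, HasDerivAt F₁ (F₂ s) s) ∧
      (∀ s, 0 ≤ χ s) ∧ (∀ s, χ s ≤ 1) ∧ (∀ s, s ≤ 1 → χ s = 1) ∧ (∀ s, 2 ≤ s → χ s = 0) ∧
      (∀ s, 0 ≤ s → |F₁ s| ≤ C * χ s ^ (m - 1)) ∧
      (∀ s, 0 ≤ s → |F₂ s| ≤ C * χ s ^ (m - 2)) := by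
  set χ : ℝ → ℝ := fun s => Real.smoothTransition (2 - s) with hχ
  have hχC : ContDiff ℝ 2 χ :=
    (Real.smoothTransition.contDiff (n := 2)).comp (contDiff_const.sub contDiff_id)
  have hχ1 : ContDiff ℝ 1 (deriv χ) := hχC.deriv' (n := 1)
  have c1 : Continuous (deriv χ) := hχ1.continuous
  have c2 : Continuous (deriv (deriv χ)) := hχ1.continuous_deriv le_rfl
  have d1 : ∀ s, HasDerivAt χ (deriv χ s) s := fun s =>
    (hχC.differentiable two_ne_zero s).hasDerivAt
  have d2 : ∀ s, HasDerivAt (deriv χ) (deriv (deriv χ) s) s := fun s =>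
    (hχ1.differentiable one_ne_zero s).hasDerivAt
  obtain ⟨A, hA⟩ := (isCompact_Icc (a := (0 : ℝ)) (b := 2)).exists_bound_of_continuousOn
    c1.continuousOn
  obtain ⟨B, hB⟩ := (isCompact_Icc (a := (0 : ℝ)) (b := 2)).exists_bound_of_continuousOn
    c2.continuousOn
  have hA0 : 0 ≤ A := (norm_nonneg _).trans (hA 0 (by simp))
  have hB0 : 0 ≤ B := (norm_nonneg _).trans (hB 0 (by simp))
  have h0 : ∀ s, 0 ≤ χ s := fun s => Real.smoothTransition.nonneg _
  have h1 : ∀ s, χ s ≤ 1 := fun s => Real.smoothTransition.le_one _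
  have hz : ∀ s, 2 ≤ s → χ s = 0 := fun s hs =>
    Real.smoothTransition.zero_of_nonpos (by linarith)
  refine ⟨m * A + (m * ((m - 1 : ℕ) * A ^ 2) + m * B), by positivity, χ,
    fun s => m * χ s ^ (m - 1) * deriv χ s,
    fun s => m * ((m - 1 : ℕ) * χ s ^ (m - 2) * deriv χ s) * deriv χ s
      + m * χ s ^ (m - 1) * deriv (deriv χ) s, hχC.pow m, fun s => (d1 s).fun_pow m, fun s => ?_,
    h0, h1, fun s hs => Real.smoothTransition.one_of_one_le (by linarith), hz,
    fun s hs => ?_, fun s hs => ?_⟩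
  · have := (((d1 s).fun_pow (m - 1)).const_mul (m : ℝ)).fun_mul (d2 s)
    rwa [show m - 1 - 1 = m - 2 by omega] at this
  · rcases le_total s 2 with h | h
    · have hAs := hA s ⟨hs, h⟩
      rw [Real.norm_eq_abs] at hAs
      rw [abs_mul, abs_of_nonneg (by have := h0 s; positivity : 0 ≤ (m : ℝ) * χ s ^ (m - 1))]
      have hp : 0 ≤ χ s ^ (m - 1) := pow_nonneg (h0 s) _
      calc (m : ℝ) * χ s ^ (m - 1) * |deriv χ s| ≤ m * χ s ^ (m - 1) * A := by gcongr
        _ = m * A * χ s ^ (m - 1) := by ring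
        _ ≤ _ := by gcongr; exact le_add_of_nonneg_right (by positivity)
    · simp only [hz s h, zero_pow (show m - 1 ≠ 0 by omega)]; simp
  · rcases le_total s 2 with h | h
    · have hAs := hA s ⟨hs, h⟩
      have hBs := hB s ⟨hs, h⟩
      rw [Real.norm_eq_abs] at hAs hBs
      have hp : 0 ≤ χ s ^ (m - 2) := pow_nonneg (h0 s) _
      have hp' : 0 ≤ χ s ^ (m - 1) := pow_nonneg (h0 s) _
      have hpp : χ s ^ (m - 1) ≤ χ s ^ (m - 2) := pow_le_pow_of_le_one (h0 s) (h1 s) (by omega)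
      refine (abs_add_le _ _).trans ?_
      simp only [abs_mul, abs_of_nonneg hp, abs_of_nonneg hp', Nat.abs_cast]
      have t1 : (m : ℝ) * ((m - 1 : ℕ) * χ s ^ (m - 2) * |deriv χ s|) * |deriv χ s|
          ≤ m * ((m - 1 : ℕ) * χ s ^ (m - 2) * A) * A := by gcongr
      have t2 : (m : ℝ) * χ s ^ (m - 1) * |deriv (deriv χ) s| ≤ m * χ s ^ (m - 2) * B := by gcongr
      have t3 : 0 ≤ m * A * χ s ^ (m - 2) := by positivity
      nlinarith
    · simp only [hz s h, zero_pow (show m - 1 ≠ 0 by omega),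
        zero_pow (show m - 2 ≠ 0 by omega)]
      simp

variable {E : Type*} [NormedAddCommGroup E] [InnerProductSpace ℝ E] [FiniteDimensional ℝ E]

/-- `η` is the root of a cutoff function `η ^ m` at scale `R`, equal to one on the ball of radius
`R` and supported in the ball of radius `2 R`; the derivatives of `η ^ m` are bounded by `C` times
the appropriate lower powers of `η`. -/
structure IsCutoffRoot (m : ℕ) (C R : ℝ) (η : E → ℝ) : Prop where
  contDiff : ContDiff ℝ 2 fun x => η x ^ m
  hasCompactSupport : HasCompactSupport fun x => η x ^ m
  nonneg : ∀ x, 0 ≤ η x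
  le_one : ∀ x, η x ≤ 1
  eq_one : ∀ x, ‖x‖ ≤ R → η x = 1
  eq_zero : ∀ x, 2 * R ≤ ‖x‖ → η x = 0
  abs_fderiv_le : ∀ x v, |fderiv ℝ (fun x => η x ^ m) x v| ≤ C * η x ^ (m - 1) * ‖v‖
  abs_laplacian_le : ∀ x, |Δ (fun x => η x ^ m) x| ≤ C * η x ^ (m - 2)

variable (E) in
theorem exists_isCutoffRoot {m : ℕ} (hm : 3 ≤ m) :
    ∃ C : ℝ, 0 ≤ C ∧ ∀ R : ℝ, 1 ≤ R → ∃ η : E → ℝ, IsCutoffRoot m C R η := by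
  obtain ⟨C, hC, χ, F₁, F₂, hF, hF₁, hF₂, h0, h1, hone, hzero, b1, b2⟩ := exists_cutoff_profile hm
  set n : ℝ := (finrank ℝ E : ℝ)
  refine ⟨(16 + 2 * n) * C, by positivity, fun R hR => ?_⟩
  have hR0 : 0 < R := by linarith
  set G : ℝ → ℝ := fun s => χ (s / R ^ 2) ^ m with hG
  have hG1 : ∀ s, HasDerivAt G (F₁ (s / R ^ 2) * (1 / R ^ 2)) s := fun s =>
    HasDerivAt.comp (h₂ := fun s => χ s ^ m) s (hF₁ (s / R ^ 2))
      ((hasDerivAt_id' s).div_const (R ^ 2))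
  have hG2 : ∀ s, HasDerivAt (fun s => F₁ (s / R ^ 2) * (1 / R ^ 2))
      (F₂ (s / R ^ 2) * (1 / R ^ 2) * (1 / R ^ 2)) s := fun s =>
    (HasDerivAt.comp s (hF₂ (s / R ^ 2)) ((hasDerivAt_id' s).div_const (R ^ 2))).mul_const _
  have hR2 : 1 / R ^ 2 ≤ 1 := by rw [div_le_one (by positivity)]; nlinarith
  have hzero' : ∀ x : E, 2 * R ≤ ‖x‖ → χ (‖x‖ ^ 2 / R ^ 2) = 0 := fun x hx => by
    refine hzero _ ?_
    rw [le_div_iff₀ (by positivity)]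
    nlinarith
  refine ⟨fun x => χ (‖x‖ ^ 2 / R ^ 2), ?_, ?_, fun x => h0 _, fun x => h1 _, fun x hx => ?_,
    hzero', fun x v => ?_, fun x => ?_⟩
  · exact hF.comp ((contDiff_id.norm_sq ℝ).div_const _)
  · refine HasCompactSupport.intro (isCompact_closedBall (0 : E) (2 * R)) fun x hx => ?_
    have hx' : 2 * R < ‖x‖ := by simpa using hx
    rw [hzero' x hx'.le, zero_pow (by omega)]
  · refine hone _ ?_
    rw [div_le_one (by positivity)]
    gcongr
  · have e := (hasFDerivAt_comp_norm_sub_sq (x := x) (z := 0) (hG1 _)).fderiv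
    simp only [sub_zero, hG] at e
    rw [e]
    rcases le_total (2 * R) ‖x‖ with hx | hx
    · have := b1 (‖x‖ ^ 2 / R ^ 2) (by positivity)
      rw [hzero' x hx, zero_pow (by omega), mul_zero] at this
      have : F₁ (‖x‖ ^ 2 / R ^ 2) = 0 := abs_nonpos_iff.1 this
      rw [this, hzero' x hx, zero_pow (by omega)]
      simp
    · simp only [_root_.smul_apply, innerSL_apply_apply, smul_eq_mul, abs_mul]
      have hb := b1 (‖x‖ ^ 2 / R ^ 2) (by positivity)
      have hi := abs_real_inner_le_norm x v
      have hxR : ‖x‖ * (1 / R ^ 2) ≤ 2 := by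
        rw [mul_one_div, div_le_iff₀ (by positivity)]
        nlinarith
      have hp : 0 ≤ χ (‖x‖ ^ 2 / R ^ 2) ^ (m - 1) := pow_nonneg (h0 _) _
      rw [abs_of_nonneg (by positivity : 0 ≤ 1 / R ^ 2), abs_of_nonneg zero_le_two]
      calc 2 * (|F₁ (‖x‖ ^ 2 / R ^ 2)| * (1 / R ^ 2)) * |inner ℝ x v|
          ≤ 2 * (C * χ (‖x‖ ^ 2 / R ^ 2) ^ (m - 1) * (1 / R ^ 2)) * (‖x‖ * ‖v‖) := by gcongr
        _ = 2 * (‖x‖ * (1 / R ^ 2)) * (C * χ (‖x‖ ^ 2 / R ^ 2) ^ (m - 1) * ‖v‖) := by ring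
        _ ≤ 2 * 2 * (C * χ (‖x‖ ^ 2 / R ^ 2) ^ (m - 1) * ‖v‖) := by gcongr
        _ ≤ (16 + 2 * n) * (C * χ (‖x‖ ^ 2 / R ^ 2) ^ (m - 1) * ‖v‖) := by
          have : 0 ≤ n := by positivity
          gcongr
          linarith
        _ = _ := by ring
  · have e := laplacian_comp_norm_sub_sq (x := x) (z := 0) (fun s _ => hG1 s) (hG2 _)
    simp only [sub_zero, hG] at e
    rw [e]
    have hp : 0 ≤ χ (‖x‖ ^ 2 / R ^ 2) ^ (m - 2) := pow_nonneg (h0 _) _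
    have hpp : χ (‖x‖ ^ 2 / R ^ 2) ^ (m - 1) ≤ χ (‖x‖ ^ 2 / R ^ 2) ^ (m - 2) :=
      pow_le_pow_of_le_one (h0 _) (h1 _) (by omega)
    have hb1 := b1 (‖x‖ ^ 2 / R ^ 2) (by positivity)
    have hb2 := b2 (‖x‖ ^ 2 / R ^ 2) (by positivity)
    rcases le_total (2 * R) ‖x‖ with hx | hx
    · rw [hzero' x hx, zero_pow (by omega), mul_zero] at hb1 hb2
      rw [abs_nonpos_iff.1 hb1, abs_nonpos_iff.1 hb2, hzero' x hx, zero_pow (by omega)]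
      simp
    · refine (abs_add_le _ _).trans ?_
      have hxR : (1 / R ^ 2) * ‖x‖ ^ 2 ≤ 4 := by
        rw [one_div_mul_eq_div, div_le_iff₀ (by positivity)]
        nlinarith [norm_nonneg x]
      have t1 : |4 * (F₂ (‖x‖ ^ 2 / R ^ 2) * (1 / R ^ 2) * (1 / R ^ 2)) * ‖x‖ ^ 2|
          ≤ 16 * (C * χ (‖x‖ ^ 2 / R ^ 2) ^ (m - 2)) := by
        rw [show 4 * (F₂ (‖x‖ ^ 2 / R ^ 2) * (1 / R ^ 2) * (1 / R ^ 2)) * ‖x‖ ^ 2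
          = 4 * ((1 / R ^ 2) * ‖x‖ ^ 2) * (1 / R ^ 2) * F₂ (‖x‖ ^ 2 / R ^ 2) by ring, abs_mul,
          abs_of_nonneg (by positivity)]
        calc 4 * (1 / R ^ 2 * ‖x‖ ^ 2) * (1 / R ^ 2) * |F₂ (‖x‖ ^ 2 / R ^ 2)|
            ≤ 4 * 4 * 1 * (C * χ (‖x‖ ^ 2 / R ^ 2) ^ (m - 2)) := by gcongr
          _ = _ := by ring
      have t2 : |2 * n * (F₁ (‖x‖ ^ 2 / R ^ 2) * (1 / R ^ 2))|
          ≤ 2 * n * (C * χ (‖x‖ ^ 2 / R ^ 2) ^ (m - 2)) := by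
        have hn : 0 ≤ n := by positivity
        rw [show 2 * n * (F₁ (‖x‖ ^ 2 / R ^ 2) * (1 / R ^ 2))
          = 2 * n * (1 / R ^ 2) * F₁ (‖x‖ ^ 2 / R ^ 2) by ring, abs_mul,
          abs_of_nonneg (by positivity)]
        calc 2 * n * (1 / R ^ 2) * |F₁ (‖x‖ ^ 2 / R ^ 2)|
            ≤ 2 * n * 1 * (C * χ (‖x‖ ^ 2 / R ^ 2) ^ (m - 1)) := by gcongr
          _ ≤ 2 * n * 1 * (C * χ (‖x‖ ^ 2 / R ^ 2) ^ (m - 2)) := by gcongr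
          _ = _ := by ring
      linarith

end Cutoff

/-! ### Polynomial growth of the energy -/

section Growth

/-- The term of weight four left over by Young's inequality is absorbed as well, up to a power of
`R`: where it dominates, `U` is bounded above and below by powers of `R / η`. -/
theorem exists_absorb_scale {p s N : ℝ} (hp : 1 < p) (hN : 0 ≤ N) :
    ∃ e : ℕ, ∀ μ K c : ℝ, 0 < μ → 0 < K → 0 < c → ∃ D, 0 ≤ D ∧ ∀ R η U : ℝ, 1 ≤ R → 0 < η → η ≤ 1 →
      0 < U → c * R ^ (-N) ≤ U →
      η ^ (e + 4) * U ^ s * (-μ * (U ^ (p - 1)) ^ 2 + K * (R / η) ^ 4) ≤ D * R ^ (e + 4) := by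
  set β := 1 / (p - 1) with hβ
  have hp0 : 0 < p - 1 := by linarith
  have hβ0 : 0 < β := by positivity
  obtain ⟨e, he⟩ := exists_nat_ge (max (2 * β * s) (-N * s))
  refine ⟨e, fun μ K c hμ hK hc => ⟨K * (Real.sqrt (K / μ) ^ (β * s) + c ^ s), by positivity,
    fun R η U hR hη hη1 hU hlow => ?_⟩⟩
  have hR0 : 0 < R := by linarith
  set l := R / η with hl
  have hRl : R ≤ l := by rw [hl, le_div_iff₀ hη]; nlinarith
  have hl1 : 1 ≤ l := hR.trans hRl
  have hl0 : 0 < l := by linarith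
  rcases le_total (-μ * (U ^ (p - 1)) ^ 2 + K * l ^ 4) 0 with h | h
  · refine (mul_nonpos_of_nonneg_of_nonpos (by positivity) h).trans (by positivity)
  have hV : U ^ s ≤ (Real.sqrt (K / μ) ^ (β * s) + c ^ s) * l ^ e := by
    rcases le_total 0 s with hs | hs
    · have h1 : U ^ (p - 1) ≤ Real.sqrt (K / μ) * l ^ 2 := by
        have : (U ^ (p - 1)) ^ 2 ≤ (Real.sqrt (K / μ) * l ^ 2) ^ 2 := by
          rw [mul_pow, Real.sq_sqrt (by positivity), div_mul_eq_mul_div, le_div_iff₀ hμ]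
          linarith
        exact (pow_le_pow_iff_left₀ (by positivity) (by positivity) two_ne_zero).1 this
      have h2 : U ^ s = (U ^ (p - 1)) ^ (β * s) := by
        rw [← Real.rpow_mul hU.le]
        congr 1
        rw [hβ]; field_simp
      calc U ^ s ≤ (Real.sqrt (K / μ) * l ^ 2) ^ (β * s) := by
            rw [h2]; gcongr
        _ = Real.sqrt (K / μ) ^ (β * s) * l ^ (2 * β * s) := by
            rw [Real.mul_rpow (by positivity) (by positivity), ← Real.rpow_natCast_mul hl0.le]
            norm_num [mul_assoc]
        _ ≤ Real.sqrt (K / μ) ^ (β * s) * l ^ (e : ℝ) := by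
            gcongr
            exact (le_max_left _ _).trans he
        _ ≤ _ := by
            rw [Real.rpow_natCast]
            gcongr
            exact le_add_of_nonneg_right (by positivity)
    · calc U ^ s ≤ (c * R ^ (-N)) ^ s :=
            Real.rpow_le_rpow_of_nonpos (by positivity) hlow hs
        _ = c ^ s * R ^ (-N * s) := by
            rw [Real.mul_rpow hc.le (by positivity), ← Real.rpow_mul hR0.le]
        _ ≤ c ^ s * l ^ (-N * s) := by
            gcongr
            nlinarith
        _ ≤ c ^ s * l ^ (e : ℝ) := by
            gcongr
            exact (le_max_right _ _).trans he
        _ ≤ _ := by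
            rw [Real.rpow_natCast]
            gcongr
            exact le_add_of_nonneg_left (by positivity)
  calc η ^ (e + 4) * U ^ s * (-μ * (U ^ (p - 1)) ^ 2 + K * l ^ 4)
      ≤ η ^ (e + 4) * ((Real.sqrt (K / μ) ^ (β * s) + c ^ s) * l ^ e) * (K * l ^ 4) := by
        gcongr
        nlinarith [sq_nonneg (U ^ (p - 1))]
    _ = K * (Real.sqrt (K / μ) ^ (β * s) + c ^ s) * (η * l) ^ (e + 4) := by
        rw [mul_pow]; ring
    _ = _ := by rw [hl, mul_div_cancel₀ _ hη.ne']

/-- The integrand of the Gidas–Spruck inequality for a solution, bounded at one point. The numbers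
`U`, `a`, `L`, `dφ`, `lφ` stand for `u`, `|∇u|`, `Δu`, `∇φ · ∇u`, `Δφ`, and `g = Δu + u ^ p`. -/
theorem exists_gidas_spruck_integrand_le {p q k μ ν lam α b C β : ℝ} (hα : 0 < α) (hμ : 0 < μ)
    (hb : b = lam * (q + p)) (hlam : lam = ν + μ) (hC : 0 ≤ C) (hβ : 0 ≤ β) :
    ∃ K, 0 < K ∧ ∀ (m : ℕ) (U a R η L g dφ lφ : ℝ), 2 ≤ m → 0 < U → 0 ≤ a → 1 ≤ R → 0 < η → η ≤ 1 →
      L = -U ^ p + g → |g| ≤ β * U + R * a → |dφ| ≤ C * η ^ (m - 1) * a →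
      |lφ| ≤ C * η ^ (m - 2) →
      (-α * (η ^ m * U ^ (q - 2) * (a ^ 2) ^ 2) + b * (η ^ m * U ^ (q - 1) * a ^ 2 * L)
        + ν * (η ^ m * U ^ q * L ^ 2) + U ^ q * L * dφ + (q - k) * (U ^ (q - 1) * a ^ 2 * dφ)
        + 1 / 2 * (U ^ q * a ^ 2 * lφ))
        + lam * (η ^ m * U ^ (q + p) * L + U ^ (q + p) * dφ
          + (q + p) * η ^ m * U ^ (q + p - 1) * a ^ 2)
      ≤ -(α / 2) * (η ^ m * U ^ (q - 2) * (a ^ 2) ^ 2) - μ / 4 * (η ^ m * U ^ (q + 2 * p))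
        + η ^ m * U ^ (q + 2) * (-(μ / 4) * (U ^ (p - 1)) ^ 2 + K * (R / η) ^ 4) := by
  obtain ⟨K, hK0, hK⟩ := exists_absorb_lower_order hα hμ b ν (lam - 2 * ν) 1 (lam - 1) (q - k)
    (1 / 2) (show (1 : ℝ) ≤ 1 + β + C by linarith)
  refine ⟨K, hK0, fun m U a R η L g dφ lφ hm hU ha hR hη hη1 hL hg hdφ hlφ => ?_⟩
  have hR0 : 0 < R := by linarith
  have hRl : R ≤ R / η := by rw [le_div_iff₀ hη]; nlinarith
  have hl1 : 1 ≤ R / η := hR.trans hRl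
  have hηl : 1 / η ≤ R / η := by gcongr
  have hηm : 0 < η ^ m := by positivity
  set z := U ^ (p - 1) with hz
  set V := U ^ (q + 2) with hV
  have hV0 : 0 < V := by positivity
  have k1 : |g / U| ≤ (1 + β + C) * ((R / η) ^ 2 + R / η * (a / U)) := by
    rw [abs_div, abs_of_pos hU, div_le_iff₀ hU]
    have e1 : (1 + β + C) * ((R / η) ^ 2 + R / η * (a / U)) * U
      = (1 + β + C) * (R / η) ^ 2 * U + (1 + β + C) * (R / η) * a := by field_simp
    rw [e1]
    have h1 : β * U ≤ (1 + β + C) * (R / η) ^ 2 * U := by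
      gcongr
      exact (show β ≤ 1 + β + C by linarith).trans
        (le_mul_of_one_le_right (by linarith) (one_le_pow₀ hl1))
    have h2 : R * a ≤ (1 + β + C) * (R / η) * a := by
      gcongr
      nlinarith
    linarith
  have k2 : |dφ / (η ^ m * U)| ≤ (1 + β + C) * (R / η * (a / U)) := by
    rw [abs_div, abs_of_pos (by positivity : 0 < η ^ m * U), div_le_iff₀ (by positivity)]
    have e1 : (1 + β + C) * (R / η * (a / U)) * (η ^ m * U)
        = (1 + β + C) * R * η ^ (m - 1) * a := by
      obtain ⟨j, rfl⟩ : ∃ j, m = j + 1 := ⟨m - 1, by omega⟩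
      rw [Nat.add_sub_cancel, pow_succ]
      field_simp
    rw [e1]
    refine hdφ.trans ?_
    gcongr
    nlinarith
  have k3 : |lφ / η ^ m| ≤ (1 + β + C) * (R / η) ^ 2 := by
    rw [abs_div, abs_of_pos hηm, div_le_iff₀ hηm]
    have e1 : (1 + β + C) * (R / η) ^ 2 * η ^ m = (1 + β + C) * R ^ 2 * η ^ (m - 2) := by
      obtain ⟨j, rfl⟩ : ∃ j, m = j + 2 := ⟨m - 2, by omega⟩
      rw [Nat.add_sub_cancel, pow_add]
      field_simp
    rw [e1]
    refine hlφ.trans ?_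
    gcongr
    exact (show C ≤ 1 + β + C by linarith).trans
      (le_mul_of_one_le_right (by linarith) (one_le_pow₀ hR))
  have key := hK (a / U) z (R / η) (g / U) (dφ / (η ^ m * U)) (lφ / η ^ m) (by positivity)
    (by positivity) hl1 k1 k2 k3
  have e1 : U ^ p = z * U := by
    rw [hz, Real.rpow_sub hU, Real.rpow_one]; field_simp
  have e2 : U ^ q = V / U ^ 2 := by
    rw [hV, Real.rpow_add hU]; norm_num; field_simp
  have e3 : U ^ (q - 1) = V / U ^ 3 := by
    rw [Real.rpow_sub hU, e2, Real.rpow_one]; field_simp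
  have e4 : U ^ (q - 2) = V / U ^ 4 := by
    rw [Real.rpow_sub hU, e2]; norm_num; field_simp
  have e5 : U ^ (q + p) = V * z / U := by
    rw [Real.rpow_add hU, e2, e1]; field_simp
  have e6 : U ^ (q + p - 1) = V * z / U ^ 2 := by
    rw [Real.rpow_sub hU, e5, Real.rpow_one]; field_simp
  have e7 : U ^ (q + 2 * p) = V * z ^ 2 := by
    rw [show q + 2 * p = q + p + p by ring, Real.rpow_add hU, e5, e1]; field_simp
  have key' := mul_le_mul_of_nonneg_left key (show 0 ≤ η ^ m * V by positivity)
  rw [e7, e6, e5, e4, e3, e2, hL, e1, hb]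
  rw [hb] at key'
  refine le_trans (le_of_eq ?_) (key'.trans (le_of_eq ?_))
  · rw [hlam]
    field_simp
    ring
  · field_simp
    ring

variable {E : Type*} [NormedAddCommGroup E] [InnerProductSpace ℝ E] [FiniteDimensional ℝ E]
  [MeasurableSpace E] [BorelSpace E]

/-- The Gidas–Spruck estimate for positive solutions: the integral of
`u ^ (q - 2) |∇u| ^ 4 + u ^ (q + 2 p)` over balls grows at most polynomially. -/
theorem exists_integral_gidas_spruck_le [Nontrivial E] {p q : ℝ} (hp : 1 < p)
    (hsub : ((finrank ℝ E : ℝ) - 2) * p < finrank ℝ E + 2) (hq : q = (1 - p) / 2)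
    {u : E → ℝ} (hu : ContDiff ℝ 2 u) (hpos : ∀ x, 0 < u x)
    (hsol : ∀ x, Δ u x = -u x ^ p + (1 / (p - 1) * u x + 1 / 2 * inner ℝ x (∇ u x)))
    {c N : ℝ} (hc : 0 < c) (hN : 0 ≤ N)
    (hlow : ∀ R, 1 ≤ R → ∀ x, ‖x‖ ≤ 2 * R → c * R ^ (-N) ≤ u x) :
    ∃ C, 0 ≤ C ∧ ∃ M : ℕ, ∀ R, 1 ≤ R → ∫ x in Metric.closedBall (0 : E) R,
      (u x ^ (q - 2) * (‖∇ u x‖ ^ 2) ^ 2 + u x ^ (q + 2 * p)) ≤ C * R ^ M := by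
  set n : ℝ := (finrank ℝ E : ℝ) with hn
  have hn1 : 1 ≤ n := by rw [hn]; exact_mod_cast finrank_pos
  obtain ⟨k, μ, hμ, hα, hb⟩ := exists_gidas_spruck_coefficients hn1 hp hsub hq
  obtain ⟨e, he⟩ := exists_absorb_scale (s := q + 2) hp hN
  obtain ⟨C, hC, hcut⟩ := exists_isCutoffRoot E (m := e + 4) (by omega)
  have hβ : 0 ≤ 1 / (p - 1) := by
    have : 0 < p - 1 := by linarith
    positivity
  set α := -((n - 1) / n * k ^ 2 - (q - 1) * k + q * (q - 1) / 2) with hαdef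
  set lam := (n - 1) / n + μ with hlam
  have hα0 : 0 < α := by linarith
  obtain ⟨K, hK0, hK⟩ := exists_gidas_spruck_integrand_le (k := k) hα0 hμ hb hlam hC hβ
  obtain ⟨D, hD0, hD⟩ := he (μ / 4) K c (by positivity) hK0 hc
  set κ := min (α / 2) (μ / 4) with hκ
  have hκ0 : 0 < κ := by positivity
  set v : ℝ := (volume (Metric.closedBall (0 : E) 1)).toReal with hv
  refine ⟨D * 2 ^ finrank ℝ E * v / κ, by positivity, e + 4 + finrank ℝ E, fun R hR => ?_⟩
  obtain ⟨η, hη⟩ := hcut R hR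
  have hR0 : 0 < R := by linarith
  have hφ0 : ∀ x, 0 ≤ η x ^ (e + 4) := fun x => pow_nonneg (hη.nonneg x) _
  have A := gidas_spruck_integral_nonneg hu hpos hη.contDiff hη.hasCompactSupport hφ0 hn q k
  have G := integral_green_rpow hu hpos hη.contDiff hη.hasCompactSupport (q + p)
  have hTint := A.1.add (G.1.const_mul lam)
  have hT := integral_add A.1 (G.1.const_mul lam)
  rw [integral_const_mul, G.2, mul_zero, add_zero] at hT
  have hT0 := A.2
  rw [← hT] at hT0
  have hr : ∀ r : ℝ, Continuous fun x => u x ^ r := fun r =>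
    hu.continuous.rpow_const fun x => Or.inl (hpos x).ne'
  have hgc : Continuous (∇ u) := (contDiff_gradient hu).continuous
  set w : E → ℝ := fun x => u x ^ (q - 2) * (‖∇ u x‖ ^ 2) ^ 2 + u x ^ (q + 2 * p) with hw
  have hwc : Continuous w := by
    have := hr (q - 2)
    have := hr (q + 2 * p)
    fun_prop
  have hw0 : ∀ x, 0 ≤ w x := fun x => by
    have := hpos x
    simp only [hw]
    positivity
  have hWint : Integrable fun x => η x ^ (e + 4) * w x :=
    (hη.contDiff.continuous.mul hwc).integrable_of_hasCompactSupport hη.hasCompactSupport.mul_right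
  set B := Metric.closedBall (0 : E) (2 * R) with hB
  have hBm : MeasurableSet B := measurableSet_closedBall
  have hBfin : volume B < ⊤ := measure_closedBall_lt_top
  have hBint : Integrable (B.indicator fun _ => D * R ^ (e + 4)) :=
    (integrable_indicator_iff hBm).2 (integrableOn_const hBfin.ne)
  have hint : ∫ x, B.indicator (fun _ => D * R ^ (e + 4)) x
      = D * 2 ^ finrank ℝ E * v * R ^ (e + 4 + finrank ℝ E) := by
    rw [integral_indicator hBm, setIntegral_const, smul_eq_mul, measureReal_def, hB,
      Measure.addHaar_closedBall' _ _ (by positivity), ENNReal.toReal_mul,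
      ENNReal.toReal_ofReal (by positivity)]
    rw [mul_pow, pow_add R (e + 4)]
    ring
  -- the pointwise bound, integrated
  have hle := integral_mono hTint (hBint.sub (hWint.const_mul κ)) fun x => by
    simp only [Pi.add_apply, Pi.sub_apply]
    rcases (hη.nonneg x).eq_or_lt with h0 | h0
    · have d0 : fderiv ℝ (fun x => η x ^ (e + 4)) x (∇ u x) = 0 := by
        have := hη.abs_fderiv_le x (∇ u x)
        rw [← h0, zero_pow (by omega)] at this
        simpa using this
      have l0 : Δ (fun x => η x ^ (e + 4)) x = 0 := by
        have := hη.abs_laplacian_le x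
        rw [← h0, zero_pow (by omega)] at this
        simpa using this
      rw [d0, l0, ← h0, zero_pow (by omega)]
      have : 0 ≤ B.indicator (fun _ => D * R ^ (e + 4)) x :=
        indicator_nonneg (fun _ _ => by positivity) x
      simpa using this
    · have hxB : ‖x‖ ≤ 2 * R := by
        by_contra! h
        exact h0.ne' (hη.eq_zero x h.le)
      have hg : |1 / (p - 1) * u x + 1 / 2 * inner ℝ x (∇ u x)|
          ≤ 1 / (p - 1) * u x + R * ‖∇ u x‖ := by
        refine (abs_add_le _ _).trans ?_
        rw [abs_of_nonneg (mul_nonneg hβ (hpos x).le), abs_mul, abs_of_pos one_half_pos]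
        have h1 := abs_real_inner_le_norm x (∇ u x)
        have h2 : ‖x‖ * ‖∇ u x‖ ≤ 2 * R * ‖∇ u x‖ := by gcongr
        linarith
      have b1 := hK (e + 4) (u x) ‖∇ u x‖ R (η x) (Δ u x) _ _ _ (by omega) (hpos x)
        (norm_nonneg _) hR h0 (hη.le_one x) (hsol x) hg (hη.abs_fderiv_le x (∇ u x))
        (hη.abs_laplacian_le x)
      have b2 := hD R (η x) (u x) hR h0 (hη.le_one x) (hpos x) (hlow R hR x hxB)
      have hxB' : x ∈ B := by simpa [hB] using hxB
      rw [indicator_of_mem hxB']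
      have w1 : 0 ≤ η x ^ (e + 4) * u x ^ (q - 2) * (‖∇ u x‖ ^ 2) ^ 2 := by
        have := hpos x
        positivity
      have w2 : 0 ≤ η x ^ (e + 4) * u x ^ (q + 2 * p) := by
        have := hpos x
        positivity
      have w3 := mul_le_mul_of_nonneg_right (min_le_left (α / 2) (μ / 4)) w1
      have w4 := mul_le_mul_of_nonneg_right (min_le_right (α / 2) (μ / 4)) w2
      rw [← hκ] at w3 w4
      have e1 : -α = (n - 1) / n * k ^ 2 - (q - 1) * k + q * (q - 1) / 2 := by rw [hαdef]; ring
      have e2 : κ * (η x ^ (e + 4) * w x) = κ * (η x ^ (e + 4) * u x ^ (q - 2) * (‖∇ u x‖ ^ 2) ^ 2)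
        + κ * (η x ^ (e + 4) * u x ^ (q + 2 * p)) := by simp only [hw]; ring
      rw [e1] at b1
      rw [e2]
      linarith
  have h1 := hT0.trans hle
  have hsubi : ∫ x, (B.indicator (fun _ => D * R ^ (e + 4)) - fun x => κ * (η x ^ (e + 4) * w x)) x
      = D * 2 ^ finrank ℝ E * v * R ^ (e + 4 + finrank ℝ E) - κ * ∫ x, η x ^ (e + 4) * w x := by
    rw [← hint, ← integral_const_mul]
    exact integral_sub hBint (hWint.const_mul κ)
  rw [hsubi] at h1
  have h2 : ∫ x in Metric.closedBall (0 : E) R, w x ≤ ∫ x, η x ^ (e + 4) * w x := by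
    rw [← integral_indicator measurableSet_closedBall]
    refine integral_mono ((integrable_indicator_iff measurableSet_closedBall).2
      (hwc.continuousOn.integrableOn_compact (isCompact_closedBall _ _))) hWint fun x => ?_
    by_cases hx : x ∈ Metric.closedBall (0 : E) R
    · rw [indicator_of_mem hx]
      simp only
      rw [hη.eq_one x (by simpa using hx)]
      simp
    · rw [indicator_of_notMem hx]
      exact mul_nonneg (hφ0 x) (hw0 x)
  rw [div_mul_eq_mul_div, le_div_iff₀ hκ0]
  nlinarith

/-- Polynomial growth of the energy densities of a positive solution. -/
theorem exists_integral_energy_le [Nontrivial E] {p : ℝ} (hp : 1 < p)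
    (hsub : ((finrank ℝ E : ℝ) - 2) * p < finrank ℝ E + 2)
    {u : E → ℝ} (hu : ContDiff ℝ 2 u) (hpos : ∀ x, 0 < u x)
    (hsol : ∀ x, Δ u x = -u x ^ p + (1 / (p - 1) * u x + 1 / 2 * inner ℝ x (∇ u x)))
    {c N : ℝ} (hc : 0 < c) (hN : 0 ≤ N)
    (hlow : ∀ R, 1 ≤ R → ∀ x, ‖x‖ ≤ 2 * R → c * R ^ (-N) ≤ u x) :
    ∃ C, 0 ≤ C ∧ ∃ M : ℕ, ∀ R, 1 ≤ R → ∫ x in Metric.closedBall (0 : E) R,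
      (‖∇ u x‖ ^ 2 + u x ^ (p + 1) + u x ^ 2) ≤ C * R ^ M := by
  set q := (1 - p) / 2 with hq
  obtain ⟨C, hC, M, hM⟩ := exists_integral_gidas_spruck_le hp hsub hq hu hpos hsol hc hN hlow
  set v : ℝ := (volume (Metric.closedBall (0 : E) 1)).toReal with hv
  refine ⟨3 * C + 3 * v, by positivity, M + finrank ℝ E, fun R hR => ?_⟩
  have hR0 : 0 < R := by linarith
  have hr : ∀ r : ℝ, Continuous fun x => u x ^ r := fun r =>
    hu.continuous.rpow_const fun x => Or.inl (hpos x).ne'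
  have hgc : Continuous (∇ u) := (contDiff_gradient hu).continuous
  have huc := hu.continuous
  have hrp := hr (p + 1)
  have hr1 := hr (q - 2)
  have hr2 := hr (q + 2 * p)
  have hcomp := isCompact_closedBall (0 : E) R
  have i1 : IntegrableOn (fun x => u x ^ (q - 2) * (‖∇ u x‖ ^ 2) ^ 2 + u x ^ (q + 2 * p))
      (Metric.closedBall (0 : E) R) :=
    (show Continuous _ by fun_prop).continuousOn.integrableOn_compact hcomp
  have i2 : IntegrableOn (fun _ => (3 : ℝ)) (Metric.closedBall (0 : E) R) :=
    integrableOn_const measure_closedBall_lt_top.ne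
  have hle : ∫ x in Metric.closedBall (0 : E) R, (‖∇ u x‖ ^ 2 + u x ^ (p + 1) + u x ^ 2)
      ≤ ∫ x in Metric.closedBall (0 : E) R,
        (3 * (u x ^ (q - 2) * (‖∇ u x‖ ^ 2) ^ 2 + u x ^ (q + 2 * p)) + 3) := by
    refine integral_mono ((show Continuous _ by fun_prop).continuousOn.integrableOn_compact hcomp)
      ((i1.const_mul 3).add i2) fun x => ?_
    have hx := hpos x
    -- the exponent `q + 2 p = (3 p + 1) / 2` exceeds `p + 1`, `2` and `2 - q`
    have pw : ∀ r, 0 ≤ r → r ≤ q + 2 * p → u x ^ r ≤ u x ^ (q + 2 * p) + 1 := fun r hr hr' => by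
      rcases le_total 1 (u x) with h | h
      · have := Real.rpow_le_rpow_of_exponent_le h hr'
        linarith
      · have := Real.rpow_le_one hx.le h hr
        have : 0 ≤ u x ^ (q + 2 * p) := by positivity
        linarith
    have p1 := pw (p + 1) (by linarith) (by rw [hq]; linarith)
    have p2 := pw 2 (by norm_num) (by rw [hq]; linarith)
    have p3 := pw (2 - q) (by rw [hq]; linarith) (by rw [hq]; linarith)
    rw [Real.rpow_two] at p2
    have p4 : ‖∇ u x‖ ^ 2 ≤ u x ^ (q - 2) * (‖∇ u x‖ ^ 2) ^ 2 + u x ^ (2 - q) := by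
      have h1 : u x ^ (2 - q) * u x ^ (q - 2) = 1 := by
        rw [← Real.rpow_add hx]; simp
      have h2 : 0 < u x ^ (2 - q) := by positivity
      have h3 : u x ^ (q - 2) = 1 / u x ^ (2 - q) := by field_simp; linarith
      rw [h3]
      rw [div_mul_eq_mul_div, one_mul, div_add' _ _ _ h2.ne', le_div_iff₀ h2]
      nlinarith [sq_nonneg (‖∇ u x‖ ^ 2 - u x ^ (2 - q)), sq_nonneg (‖∇ u x‖ ^ 2)]
    have p5 : 0 ≤ u x ^ (q - 2) * (‖∇ u x‖ ^ 2) ^ 2 := by positivity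
    simp only
    linarith
  refine hle.trans ?_
  rw [integral_add (i1.const_mul 3) i2, integral_const_mul, setIntegral_const, smul_eq_mul,
    measureReal_def, Measure.addHaar_closedBall' _ _ hR0.le, ENNReal.toReal_mul,
    ENNReal.toReal_ofReal (by positivity)]
  have h1 := hM R hR
  have h2 : R ^ M ≤ R ^ (M + finrank ℝ E) := pow_le_pow_right₀ hR (by omega)
  have h3 : R ^ finrank ℝ E ≤ R ^ (M + finrank ℝ E) := pow_le_pow_right₀ hR (by omega)
  have h4 := mul_le_mul_of_nonneg_left h2 hC
  have h5 := mul_le_mul_of_nonneg_right h3 (show 0 ≤ v by positivity)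
  nlinarith

end Growth

/-! ### The Pohozaev identity -/

section Pohozaev

variable {E : Type*} [NormedAddCommGroup E] [InnerProductSpace ℝ E] [FiniteDimensional ℝ E]

omit [FiniteDimensional ℝ E] in
theorem contDiff_gaussian : ContDiff ℝ 1 fun x : E => Real.exp (-(‖x‖ ^ 2 / 4)) :=
  (((contDiff_id.norm_sq ℝ).div_const _).neg).exp

omit [FiniteDimensional ℝ E] in
theorem fderiv_gaussian_apply (x v : E) :
    fderiv ℝ (fun x : E => Real.exp (-(‖x‖ ^ 2 / 4))) x v
      = -(1 / 2) * inner ℝ x v * Real.exp (-(‖x‖ ^ 2 / 4)) := by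
  have h : HasDerivAt (fun s : ℝ => Real.exp (-(s / 4)))
      (Real.exp (-(‖x - 0‖ ^ 2 / 4)) * -(1 / 4)) (‖x - 0‖ ^ 2) :=
    ((hasDerivAt_id' _).div_const 4).fun_neg.exp
  have := (hasFDerivAt_comp_norm_sub_sq (x := x) (z := 0) h).fderiv
  simp only [sub_zero] at this
  rw [this]
  simp
  ring

theorem gradient_half_norm_sq (x : E) : ∇ (fun y : E => ‖y‖ ^ 2 / 2) x = x := by
  have h : HasDerivAt (fun s : ℝ => s / 2) (1 / 2) (‖x - 0‖ ^ 2) :=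
    (hasDerivAt_id' _).div_const 2
  have := gradient_comp_norm_sub_sq (x := x) (z := 0) h
  simpa only [sub_zero, mul_one_div_cancel (two_ne_zero' ℝ), one_smul] using this

theorem laplacian_half_norm_sq (x : E) :
    Δ (fun y : E => (‖y‖ ^ 2 / 2 : ℝ)) x = (finrank ℝ E : ℝ) := by
  have h : ∀ s : ℝ, 0 ≤ s → HasDerivAt (fun s : ℝ => s / 2) ((fun _ => 1 / 2) s) s := fun s _ =>
    (hasDerivAt_id' _).div_const 2
  have := laplacian_comp_norm_sub_sq (x := x) (z := 0) h (hasDerivAt_const _ _)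
  simp only [sub_zero] at this
  rw [this]
  ring

variable [MeasurableSpace E] [BorelSpace E]

/-- The Giga–Kohn Pohozaev identity with a cutoff function `φ`. It combines the equation tested with
`x · ∇u`, `u` and `|x|² u` against the Gaussian weight; the coefficients are such that all terms
without a derivative of `u` or of `φ` cancel. -/
theorem integral_pohozaev_eq_zero {p β n : ℝ} (hp : 1 < p) (hβ : β = 1 / (p - 1))
    (hn : n = finrank ℝ E)
    {u φ : E → ℝ} (hu : ContDiff ℝ 2 u) (hpos : ∀ x, 0 < u x)
    (hsol : ∀ x, Δ u x = -u x ^ p + (β * u x + 1 / 2 * inner ℝ x (∇ u x)))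
    (hφ : ContDiff ℝ 1 φ) (hc : HasCompactSupport φ) :
    Integrable (fun x => Real.exp (-(‖x‖ ^ 2 / 4)) *
      (φ x * (((n + 2) - (n - 2) * p) / (2 * (p + 1)) * ‖∇ u x‖ ^ 2
          + (p - 1) / (4 * (p + 1)) * (‖x‖ ^ 2 * ‖∇ u x‖ ^ 2))
        + fderiv ℝ φ x (∇ u x)
          * (inner ℝ x (∇ u x) + u x * (n / (p + 1) + -(1 / (2 * (p + 1))) * ‖x‖ ^ 2))
        + fderiv ℝ φ x x * ((1 / (2 * (p + 1)) - β / 2) * u x ^ 2 - 1 / 2 * ‖∇ u x‖ ^ 2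
          + 1 / (p + 1) * u x ^ (p + 1)))) ∧
    ∫ x, Real.exp (-(‖x‖ ^ 2 / 4)) *
      (φ x * (((n + 2) - (n - 2) * p) / (2 * (p + 1)) * ‖∇ u x‖ ^ 2
          + (p - 1) / (4 * (p + 1)) * (‖x‖ ^ 2 * ‖∇ u x‖ ^ 2))
        + fderiv ℝ φ x (∇ u x)
          * (inner ℝ x (∇ u x) + u x * (n / (p + 1) + -(1 / (2 * (p + 1))) * ‖x‖ ^ 2))
        + fderiv ℝ φ x x * ((1 / (2 * (p + 1)) - β / 2) * u x ^ 2 - 1 / 2 * ‖∇ u x‖ ^ 2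
          + 1 / (p + 1) * u x ^ (p + 1))) = 0 := by
  have hp1 : p + 1 ≠ 0 := by linarith
  have hu1 : ContDiff ℝ 1 u := hu.of_le (by norm_num)
  have hd : ∀ {f : E → ℝ}, ContDiff ℝ 1 f → ∀ x, DifferentiableAt ℝ f x := fun h x =>
    h.differentiable one_ne_zero x
  have hX : ContDiff ℝ 1 fun x => inner ℝ x (∇ u x) := contDiff_id.inner ℝ (contDiff_gradient hu)
  have hr2 : ContDiff ℝ 1 fun x : E => ‖x‖ ^ 2 := contDiff_id.norm_sq ℝ
  have hg1 : ContDiff ℝ 1 fun x => ‖∇ u x‖ ^ 2 := (contDiff_gradient hu).norm_sq ℝ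
  have hup : ContDiff ℝ 1 fun x => u x ^ (p + 1) := hu1.rpow_const_of_ne fun x => (hpos x).ne'
  have hu2 : ContDiff ℝ 1 fun x => u x ^ 2 := hu1.pow 2
  set A := n / (p + 1) with hA
  set b := -(1 / (2 * (p + 1))) with hb
  set ρ : E → ℝ := fun x => Real.exp (-(‖x‖ ^ 2 / 4)) with hρ
  have hρC : ContDiff ℝ 1 ρ := contDiff_gaussian
  have hab : ContDiff ℝ 1 fun x : E => A + b * ‖x‖ ^ 2 :=
    contDiff_const.add (contDiff_const.mul hr2)
  set h₁ : E → ℝ := fun x => inner ℝ x (∇ u x) + u x * (A + b * ‖x‖ ^ 2) with hh₁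
  have hh₁C : ContDiff ℝ 1 h₁ := hX.add (hu1.mul hab)
  set h₂ : E → ℝ := fun x => (1 / (2 * (p + 1)) - β / 2) * u x ^ 2 - 1 / 2 * ‖∇ u x‖ ^ 2
    + 1 / (p + 1) * u x ^ (p + 1) with hh₂
  have hh₂C : ContDiff ℝ 1 h₂ := ((contDiff_const.mul hu2).sub (contDiff_const.mul hg1)).add
    (contDiff_const.mul hup)
  have dr2 : ∀ x v : E, fderiv ℝ (fun x : E => ‖x‖ ^ 2) x v = 2 * inner ℝ x v := fun x v => by
    have h := (hasFDerivAt_id x).norm_sq.fderiv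
    simp only [id] at h
    rw [h]
    simp
  have dab : ∀ x v : E, fderiv ℝ (fun x : E => A + b * ‖x‖ ^ 2) x v = b * (2 * inner ℝ x v) :=
    fun x v => by
    rw [fderiv_const_add, fderiv_const_mul (hd hr2 x), _root_.smul_apply, dr2, smul_eq_mul]
  have dh₁ : ∀ x v, fderiv ℝ h₁ x v = fderiv ℝ u x v + fderiv ℝ (fderiv ℝ u) x v x
      + (u x * (b * (2 * inner ℝ x v)) + (A + b * ‖x‖ ^ 2) * fderiv ℝ u x v) := fun x v => by
    rw [hh₁, fderiv_fun_add (hd hX x) (hd (hu1.mul hab) x), _root_.add_apply,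
      fderiv_inner_gradient hu, fderiv_mul_apply_of_contDiff hu1 hab, dab]
  have du2 : ∀ x v, fderiv ℝ (fun x => u x ^ 2) x v = 2 * u x * fderiv ℝ u x v := fun x v => by
    simp_rw [sq]
    rw [fderiv_mul_apply_of_contDiff hu1 hu1]
    ring
  have dh₂ : ∀ x v, fderiv ℝ h₂ x v = (1 / (2 * (p + 1)) - β / 2) * (2 * u x * fderiv ℝ u x v)
      - fderiv ℝ (fderiv ℝ u) x v (∇ u x) + u x ^ p * fderiv ℝ u x v := fun x v => by
    rw [hh₂, fderiv_fun_add ((hd (contDiff_const.mul hu2) x).fun_sub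
        (hd (contDiff_const.mul hg1) x)) (hd (contDiff_const.mul hup) x),
      fderiv_fun_sub (hd (contDiff_const.mul hu2) x) (hd (contDiff_const.mul hg1) x),
      fderiv_const_mul (hd hu2 x), fderiv_const_mul (hd hg1 x), fderiv_const_mul (hd hup x)]
    simp only [_root_.add_apply, _root_.sub_apply, _root_.smul_apply, smul_eq_mul, du2,
      fderiv_norm_sq_gradient hu, fderiv_rpow_const_apply hu hpos, add_sub_cancel_right]
    field_simp
  have G₁ := integral_mul_laplacian_add_fderiv_gradient (ψ := fun x => φ x * (ρ x * h₁ x))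
    (hφ.mul (hρC.mul hh₁C)) hu (Or.inl hc.mul_right)
  have G₂ := integral_mul_laplacian_add_fderiv_gradient (ψ := fun x => φ x * (ρ x * h₂ x))
    (hφ.mul (hρC.mul hh₂C)) (w := fun x : E => ‖x‖ ^ 2 / 2) ((contDiff_id.norm_sq ℝ).div_const _)
    (Or.inl hc.mul_right)
  have hint := integral_add G₁.1 G₂.1
  rw [G₁.2, G₂.2, add_zero] at hint
  have hint' := G₁.1.add G₂.1
  have key : (fun x => ρ x *
      (φ x * (((n + 2) - (n - 2) * p) / (2 * (p + 1)) * ‖∇ u x‖ ^ 2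
          + (p - 1) / (4 * (p + 1)) * (‖x‖ ^ 2 * ‖∇ u x‖ ^ 2))
        + fderiv ℝ φ x (∇ u x) * h₁ x + fderiv ℝ φ x x * h₂ x)) = fun x =>
      (φ x * (ρ x * h₁ x) * Δ u x + fderiv ℝ (fun x => φ x * (ρ x * h₁ x)) x (∇ u x))
      + (φ x * (ρ x * h₂ x) * Δ (fun x : E => (‖x‖ ^ 2 / 2 : ℝ)) x
        + fderiv ℝ (fun x => φ x * (ρ x * h₂ x)) x (∇ (fun x : E => ‖x‖ ^ 2 / 2) x)) := by
    funext x
    have ex : fderiv ℝ u x x = inner ℝ x (∇ u x) := by rw [real_inner_comm, inner_gradient_left]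
    rw [gradient_half_norm_sq, laplacian_half_norm_sq, ← hn,
      fderiv_mul_apply_of_contDiff hφ (hρC.mul hh₁C), fderiv_mul_apply_of_contDiff hρC hh₁C,
      fderiv_mul_apply_of_contDiff hφ (hρC.mul hh₂C), fderiv_mul_apply_of_contDiff hρC hh₂C,
      dh₁, dh₂, hρ, fderiv_gaussian_apply, fderiv_gaussian_apply, fderiv_apply_gradient_self,
      real_inner_self_eq_norm_sq, hsol, fderiv_fderiv_symm hu x x (∇ u x), ex]
    have e1 : u x ^ (p + 1) = u x ^ p * u x := by rw [Real.rpow_add (hpos x), Real.rpow_one]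
    have hp2 : p - 1 ≠ 0 := by linarith
    simp only [hh₁, hh₂, hA, hb, hβ, e1]
    field_simp
    ring
  rw [key]
  exact ⟨hint', hint⟩

end Pohozaev

/-! ### Vanishing of the gradient -/

section Conclusion

variable {E : Type*} [NormedAddCommGroup E] [InnerProductSpace ℝ E] [FiniteDimensional ℝ E]

theorem energy_error_le {g U V a b c C R : ℝ} (hg : 0 ≤ g) (hU : 0 ≤ U) (hV : 0 ≤ V) (ha : 0 ≤ a)
    (hb : 0 ≤ b) (hc : 0 ≤ c) (hC : 0 ≤ C) (hR : 1 ≤ R) :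
    C * g * (2 * R * g + U * (a + 4 * b * R ^ 2))
        + C * (2 * R) * (c * U ^ 2 + 1 / 2 * g ^ 2 + V)
      ≤ C * (3 + a + 4 * b + 2 * c) * R ^ 2 * (g ^ 2 + V + U ^ 2) := by
  have hRR : R ≤ R ^ 2 := le_self_pow₀ hR two_ne_zero
  have hR2 : 1 ≤ R ^ 2 := one_le_pow₀ hR
  have hgU : g * U ≤ g ^ 2 + V + U ^ 2 := by nlinarith [sq_nonneg (g - U), mul_nonneg hg hU]
  have h1 : R * (2 * g ^ 2) ≤ R ^ 2 * (2 * g ^ 2) := by gcongr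
  have h2 : (a + 4 * b * R ^ 2) * (g * U) ≤ (a * R ^ 2 + 4 * b * R ^ 2) * (g ^ 2 + V + U ^ 2) := by
    gcongr
    exact le_mul_of_one_le_right ha hR2
  have h3 : R * (2 * (c * U ^ 2 + 1 / 2 * g ^ 2 + V))
      ≤ R ^ 2 * (2 * (c * U ^ 2 + 1 / 2 * g ^ 2 + V)) := by gcongr
  have h4 : 0 ≤ 2 * c * g ^ 2 + (2 * c + 1) * V + 3 * U ^ 2 := by positivity
  have h5 := mul_nonneg (sq_nonneg R) h4
  have h6 : g * (2 * R * g + U * (a + 4 * b * R ^ 2)) + 2 * R * (c * U ^ 2 + 1 / 2 * g ^ 2 + V)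
      ≤ (3 + a + 4 * b + 2 * c) * R ^ 2 * (g ^ 2 + V + U ^ 2) := by linarith
  have h7 := mul_le_mul_of_nonneg_left h6 hC
  linarith

/-- The terms of the Pohozaev identity containing derivatives of the cutoff function are supported
where the Gaussian weight is at most `exp (-R² / 4)`. -/
theorem abs_pohozaev_error_le {p A b c C R : ℝ} (hp : 1 < p) (hC : 0 ≤ C) (hR : 1 ≤ R)
    {u η : E → ℝ} (hpos : ∀ x, 0 < u x) (hη : IsCutoffRoot 3 C R η) (x : E) :
    |Real.exp (-(‖x‖ ^ 2 / 4)) * (fderiv ℝ (fun x => η x ^ 3) x (∇ u x)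
          * (inner ℝ x (∇ u x) + u x * (A + b * ‖x‖ ^ 2))
        + fderiv ℝ (fun x => η x ^ 3) x x * (c * u x ^ 2 - 1 / 2 * ‖∇ u x‖ ^ 2
          + 1 / (p + 1) * u x ^ (p + 1)))|
      ≤ (Metric.closedBall (0 : E) (2 * R)).indicator (fun x =>
        Real.exp (-(R ^ 2 / 4)) * (C * (3 + |A| + 4 * |b| + 2 * |c|) * R ^ 2) *
          (‖∇ u x‖ ^ 2 + u x ^ (p + 1) + u x ^ 2)) x := by
  have hR0 : 0 < R := by linarith
  have hux := hpos x
  have hup : 0 < u x ^ (p + 1) := by positivity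
  have hrhs : 0 ≤ (Metric.closedBall (0 : E) (2 * R)).indicator (fun x =>
        Real.exp (-(R ^ 2 / 4)) * (C * (3 + |A| + 4 * |b| + 2 * |c|) * R ^ 2) *
          (‖∇ u x‖ ^ 2 + u x ^ (p + 1) + u x ^ 2)) x :=
    indicator_nonneg (fun y _ => by have := hpos y; positivity) x
  have hφ : ∀ v, |fderiv ℝ (fun x => η x ^ 3) x v| ≤ C * ‖v‖ := fun v => by
    refine (hη.abs_fderiv_le x v).trans ?_
    have : η x ^ (3 - 1) ≤ 1 := pow_le_one₀ (hη.nonneg x) (hη.le_one x)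
    have h2 : C * η x ^ (3 - 1) ≤ C * 1 := by gcongr
    rw [mul_one] at h2
    gcongr
  rcases lt_or_ge ‖x‖ R with h | h
  · have h1 : (fun x => η x ^ 3) =ᶠ[𝓝 x] fun _ => 1 := by
      filter_upwards [continuous_norm.continuousAt.eventually (gt_mem_nhds h)] with y hy
      rw [hη.eq_one y hy.le, one_pow]
    have h2 : fderiv ℝ (fun x => η x ^ 3) x = 0 := by
      rw [h1.fderiv_eq, fderiv_fun_const]; rfl
    rw [h2]
    simpa using hrhs
  rcases lt_or_ge (2 * R) ‖x‖ with h' | h'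
  · have h2 : ∀ v, fderiv ℝ (fun x => η x ^ 3) x v = 0 := fun v => by
      have := hη.abs_fderiv_le x v
      rw [hη.eq_zero x h'.le] at this
      simpa using this
    rw [h2, h2]
    simpa using hrhs
  rw [indicator_of_mem (by simpa using h'), abs_mul, abs_of_pos (Real.exp_pos _), mul_assoc]
  refine mul_le_mul (Real.exp_le_exp.2 (by gcongr)) ?_ (abs_nonneg _) (Real.exp_pos _).le
  set g := ‖∇ u x‖ with hg
  have hg0 : 0 ≤ g := norm_nonneg _
  have b1 : |inner ℝ x (∇ u x) + u x * (A + b * ‖x‖ ^ 2)|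
      ≤ 2 * R * g + u x * (|A| + 4 * |b| * R ^ 2) := by
    refine (abs_add_le _ _).trans (add_le_add ?_ ?_)
    · exact (abs_real_inner_le_norm x _).trans (by gcongr)
    · rw [abs_mul, abs_of_pos hux]
      gcongr
      refine (abs_add_le _ _).trans ?_
      gcongr
      rw [abs_mul, abs_of_nonneg (by positivity : 0 ≤ ‖x‖ ^ 2)]
      have : ‖x‖ ^ 2 ≤ (2 * R) ^ 2 := by gcongr
      have := mul_le_mul_of_nonneg_left this (abs_nonneg b)
      linarith
  have hpi : 1 / (p + 1) ≤ 1 := by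
    rw [div_le_one (by linarith)]; linarith
  have b2 : |c * u x ^ 2 - 1 / 2 * g ^ 2 + 1 / (p + 1) * u x ^ (p + 1)|
      ≤ |c| * u x ^ 2 + 1 / 2 * g ^ 2 + u x ^ (p + 1) := by
    have h0 : 0 < 1 / (p + 1) := by
      have : 0 < p + 1 := by linarith
      positivity
    have h1 : 1 / (p + 1) * u x ^ (p + 1) ≤ u x ^ (p + 1) :=
      mul_le_of_le_one_left hup.le hpi
    have h2 : 0 ≤ 1 / (p + 1) * u x ^ (p + 1) := by positivity
    have h3 := mul_le_mul_of_nonneg_right (le_abs_self c) (sq_nonneg (u x))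
    have h4 := mul_le_mul_of_nonneg_right (neg_abs_le c) (sq_nonneg (u x))
    rw [abs_le]
    constructor <;> nlinarith [sq_nonneg g]
  refine (abs_add_le _ _).trans ?_
  rw [abs_mul, abs_mul]
  have t1 : |fderiv ℝ (fun x => η x ^ 3) x (∇ u x)|
        * |inner ℝ x (∇ u x) + u x * (A + b * ‖x‖ ^ 2)|
      ≤ C * g * (2 * R * g + u x * (|A| + 4 * |b| * R ^ 2)) := by
    gcongr
    exact hφ _
  have t2 : |fderiv ℝ (fun x => η x ^ 3) x x|
        * |c * u x ^ 2 - 1 / 2 * g ^ 2 + 1 / (p + 1) * u x ^ (p + 1)|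
      ≤ C * (2 * R) * (|c| * u x ^ 2 + 1 / 2 * g ^ 2 + u x ^ (p + 1)) := by
    gcongr
    exact (hφ x).trans (by gcongr)
  exact (add_le_add t1 t2).trans (energy_error_le hg0 hux.le hup.le (abs_nonneg A) (abs_nonneg b)
    (abs_nonneg c) hC hR)

variable [MeasurableSpace E] [BorelSpace E]

/-- A positive solution with polynomially growing energy has vanishing gradient, by the Pohozaev
identity: the cutoff error tends to zero because of the Gaussian weight. -/
theorem gradient_eq_zero_of_energy_growth {p β : ℝ} (hp : 1 < p) (hβ : β = 1 / (p - 1))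
    (hsub : ((finrank ℝ E : ℝ) - 2) * p < finrank ℝ E + 2)
    {u : E → ℝ} (hu : ContDiff ℝ 2 u) (hpos : ∀ x, 0 < u x)
    (hsol : ∀ x, Δ u x = -u x ^ p + (β * u x + 1 / 2 * inner ℝ x (∇ u x)))
    {K : ℝ} {M : ℕ} (hgrowth : ∀ R, 1 ≤ R → ∫ x in Metric.closedBall (0 : E) R,
      (‖∇ u x‖ ^ 2 + u x ^ (p + 1) + u x ^ 2) ≤ K * R ^ M) (x : E) : ∇ u x = 0 := by
  set n : ℝ := (finrank ℝ E : ℝ) with hn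
  set κ := ((n + 2) - (n - 2) * p) / (2 * (p + 1)) with hκ
  have hκ0 : 0 < κ := div_pos (by linarith) (by linarith)
  have hκ' : 0 ≤ (p - 1) / (4 * (p + 1)) := div_nonneg (by linarith) (by linarith)
  obtain ⟨C, hC, hcut⟩ := exists_isCutoffRoot E (m := 3) le_rfl
  have hgc : Continuous (∇ u) := (contDiff_gradient hu).continuous
  have huc := hu.continuous
  have hup : Continuous fun x => u x ^ (p + 1) := huc.rpow_const fun x => Or.inl (hpos x).ne'
  have hρ : Continuous fun x : E => Real.exp (-(‖x‖ ^ 2 / 4)) := contDiff_gaussian.continuous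
  set D := C * (3 + |n / (p + 1)| + 4 * |-(1 / (2 * (p + 1)))|
    + 2 * |1 / (2 * (p + 1)) - β / 2|) with hD
  have hD0 : 0 ≤ D := by positivity
  have hfint : ∀ R η, IsCutoffRoot (E := E) 3 C R η →
      Integrable fun x => Real.exp (-(‖x‖ ^ 2 / 4)) * (η x ^ 3 * ‖∇ u x‖ ^ 2) := fun R η hη => by
    have := hη.contDiff.continuous
    exact (show Continuous _ by fun_prop).integrable_of_hasCompactSupport
      (hη.hasCompactSupport.mul_right.mul_left)
  have hbound : ∀ R η, 1 ≤ R → IsCutoffRoot (E := E) 3 C R η →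
      κ * ∫ x, Real.exp (-(‖x‖ ^ 2 / 4)) * (η x ^ 3 * ‖∇ u x‖ ^ 2)
        ≤ Real.exp (-(R ^ 2 / 4)) * (D * R ^ 2) * (K * (2 * R) ^ M) := by
    intro R η hR hη
    have P := integral_pohozaev_eq_zero hp hβ hn hu hpos hsol (hη.contDiff.of_le (by norm_num))
      hη.hasCompactSupport
    have i2 : IntegrableOn (fun x => Real.exp (-(R ^ 2 / 4)) * (D * R ^ 2) *
        (‖∇ u x‖ ^ 2 + u x ^ (p + 1) + u x ^ 2)) (Metric.closedBall (0 : E) (2 * R)) :=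
      (show Continuous _ by fun_prop).continuousOn.integrableOn_compact (isCompact_closedBall _ _)
    have i3 := (integrable_indicator_iff (μ := volume)
      (measurableSet_closedBall (x := (0 : E)) (ε := 2 * R))).2 i2
    have hle := integral_mono ((hfint R η hη).const_mul κ) (P.1.add i3) fun x => by
      have h1 := abs_pohozaev_error_le (A := n / (p + 1)) (b := -(1 / (2 * (p + 1))))
        (c := 1 / (2 * (p + 1)) - β / 2) hp hC hR hpos hη x
      have h2 := (neg_le_abs _).trans h1
      have h3 : 0 ≤ Real.exp (-(‖x‖ ^ 2 / 4)) * (η x ^ 3 *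
          ((p - 1) / (4 * (p + 1)) * (‖x‖ ^ 2 * ‖∇ u x‖ ^ 2))) := by
        have := hη.nonneg x
        positivity
      simp only [Pi.add_apply]
      rw [hD, hκ]
      linarith
    have hadd := integral_add P.1 i3
    rw [P.2, zero_add, integral_indicator measurableSet_closedBall, integral_const_mul] at hadd
    rw [integral_const_mul] at hle
    refine hle.trans (hadd.le.trans ?_)
    gcongr
    exact hgrowth (2 * R) (by linarith)
  have hlim : Tendsto (fun R : ℝ => Real.exp (-(R ^ 2 / 4)) * (D * R ^ 2) * (K * (2 * R) ^ M))
      atTop (𝓝 0) := by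
    have h1 := (tendsto_rpow_mul_exp_neg_mul_atTop_nhds_zero ((M + 2 : ℕ) / 2 : ℝ) (1 / 4)
      (by norm_num)).comp (tendsto_pow_atTop (α := ℝ) two_ne_zero)
    have h2 := h1.const_mul (D * K * 2 ^ M)
    rw [mul_zero] at h2
    refine h2.congr' ?_
    filter_upwards [eventually_ge_atTop 0] with R hR
    have h3 : (R ^ 2) ^ ((M + 2 : ℕ) / 2 : ℝ) = R ^ (M + 2) := by
      rw [← Real.rpow_natCast_mul hR, Nat.cast_ofNat, mul_div_cancel₀ _ (two_ne_zero' ℝ),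
        Real.rpow_natCast]
    simp only [Function.comp_apply]
    rw [h3, mul_pow, pow_add, show -(1 / 4) * R ^ 2 = -(R ^ 2 / 4) by ring]
    ring
  -- a fixed cutoff function which is positive at `x` is below all cutoff functions of large scale
  set r := max 1 ‖x‖ with hr
  obtain ⟨θ, hθ⟩ := hcut r (le_max_left _ _)
  have hf : Continuous fun x => Real.exp (-(‖x‖ ^ 2 / 4)) * (θ x ^ 3 * ‖∇ u x‖ ^ 2) := by
    have := hθ.contDiff.continuous
    fun_prop
  have hf0 : ∀ x, 0 ≤ Real.exp (-(‖x‖ ^ 2 / 4)) * (θ x ^ 3 * ‖∇ u x‖ ^ 2) := fun x => by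
    have := hθ.nonneg x
    positivity
  have hzero : κ * ∫ x, Real.exp (-(‖x‖ ^ 2 / 4)) * (θ x ^ 3 * ‖∇ u x‖ ^ 2) ≤ 0 := by
    refine ge_of_tendsto hlim ?_
    filter_upwards [eventually_ge_atTop (2 * r)] with R hR
    have hr1 : 1 ≤ r := le_max_left _ _
    obtain ⟨η, hη⟩ := hcut R (by linarith)
    refine le_trans ?_ (hbound R η (by linarith) hη)
    refine mul_le_mul_of_nonneg_left
      (integral_mono (hfint r θ hθ) (hfint R η hη) fun y => ?_) hκ0.le
    rcases le_total ‖y‖ R with h | h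
    · have : θ y ^ 3 ≤ η y ^ 3 := by
        rw [hη.eq_one y h, one_pow]
        exact pow_le_one₀ (hθ.nonneg y) (hθ.le_one y)
      simp only
      gcongr
    · have := hη.nonneg y
      simp only
      rw [hθ.eq_zero y (hR.trans h)]
      simp only [ne_eq, OfNat.ofNat_ne_zero, not_false_eq_true, zero_pow, zero_mul, mul_zero]
      positivity
  by_contra hx
  have hpos' := hf.integral_pos_of_hasCompactSupport_nonneg_nonzero (μ := volume) (x := x)
    (hθ.hasCompactSupport.mul_right.mul_left) hf0 (by
      rw [hθ.eq_one x (le_max_right _ _)]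
      have := norm_pos_iff.2 hx
      positivity)
  nlinarith

omit [MeasurableSpace E] [BorelSpace E] in
/-- A nonnegative solution in the subcritical range has vanishing gradient. -/
theorem gradient_eq_zero_of_nonneg_solution [Nontrivial E] {p : ℝ} (hp : 1 < p)
    (hsub : ((finrank ℝ E : ℝ) - 2) * p < finrank ℝ E + 2)
    {u : E → ℝ} (hu : ContDiff ℝ 2 u) (hnn : ∀ x, 0 ≤ u x)
    (hsol : ∀ x, Δ u x - 1 / 2 * inner ℝ x (∇ u x) + |u x| ^ (p - 1) * u x
      - 1 / (p - 1) * u x = 0) (x : E) : ∇ u x = 0 := by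
  borelize E
  by_cases hz : ∃ z, 0 < u z
  swap
  · push Not at hz
    have : u = fun _ => 0 := funext fun y => le_antisymm (hz y) (hnn y)
    rw [this, gradient_fun_const]
  obtain ⟨z, hz⟩ := hz
  have hp0 : 0 < p - 1 := by linarith
  obtain ⟨δ, hδ, m, hm, hlow⟩ := exists_rpow_le_of_supersolution hu hnn
    (β := 1 / (p - 1)) (by positivity) (fun y => by
      have h1 := hsol y
      have h2 : 0 ≤ |u y| ^ (p - 1) * u y := mul_nonneg (by positivity) (hnn y)
      linarith) hz
  have hpos : ∀ y, 0 < u y := fun y => lt_of_lt_of_le (by positivity) (hlow y)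
  have hsol' : ∀ y, Δ u y = -u y ^ p + (1 / (p - 1) * u y + 1 / 2 * inner ℝ y (∇ u y)) :=
    fun y => by
    have h1 := hsol y
    have h2 : |u y| ^ (p - 1) * u y = u y ^ p := by
      rw [abs_of_pos (hpos y), Real.rpow_sub (hpos y), Real.rpow_one,
        div_mul_cancel₀ _ (hpos y).ne']
    rw [h2] at h1
    linarith
  have hlow' : ∀ R, 1 ≤ R → ∀ y, ‖y‖ ≤ 2 * R →
      δ * (9 + 2 * ‖z‖ ^ 2) ^ (-m) * R ^ (-(2 * m)) ≤ u y := by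
    intro R hR y hy
    have hR0 : 0 < R := by linarith
    refine le_trans ?_ (hlow y)
    have h1 : R ^ (-(2 * m)) = (R ^ 2) ^ (-m) := by
      rw [← Real.rpow_natCast_mul hR0.le]
      congr 1
      push_cast
      ring
    rw [h1, mul_assoc, ← Real.mul_rpow (by positivity) (by positivity)]
    refine mul_le_mul_of_nonneg_left ?_ hδ.le
    refine Real.rpow_le_rpow_of_nonpos (by positivity) ?_ (by linarith)
    have h2 : ‖y - z‖ ≤ 2 * R + ‖z‖ := (norm_sub_le _ _).trans (by gcongr)
    have h3 : ‖y - z‖ ^ 2 ≤ (2 * R + ‖z‖) ^ 2 := by gcongr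
    have h4 : ‖z‖ ^ 2 ≤ ‖z‖ ^ 2 * R ^ 2 := le_mul_of_one_le_right (by positivity) (one_le_pow₀ hR)
    nlinarith [sq_nonneg (2 * R - ‖z‖), one_le_pow₀ hR (n := 2)]
  obtain ⟨K, -, M, hM⟩ := exists_integral_energy_le hp hsub hu hpos hsol'
    (show 0 < δ * (9 + 2 * ‖z‖ ^ 2) ^ (-m) by positivity) (show 0 ≤ 2 * m by positivity) hlow'
  exact gradient_eq_zero_of_energy_growth hp rfl hsub hu hpos hsol' hM x

theorem sub_two_mul_lt_of_lt_criticalExponent {n : ℕ} {p : ℝ} (hp : 1 < p)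
    (h : (p : EReal) < criticalExponent n) : ((n : ℝ) - 2) * p < n + 2 := by
  unfold criticalExponent at h
  split_ifs at h with hn
  · have h2 : (n : ℝ) ≤ 2 := by exact_mod_cast hn
    have h0 : (0 : ℝ) ≤ n := n.cast_nonneg
    nlinarith
  · have h2 : (2 : ℝ) < n := by exact_mod_cast not_le.1 hn
    rw [EReal.coe_lt_coe_iff, lt_div_iff₀ (by linarith)] at h
    linarith

end Conclusion

end

theorem mainTheorem1 (n : ℕ) (hn : 1 ≤ n) (p : ℝ) (hp : 1 < p)
    (hp' : (p : EReal) < criticalExponent n)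
    (u : EuclideanSpace ℝ (Fin n) → ℝ) (hu : IsClassicalSolution n p u)
    (hu_nonneg : ∀ x, 0 ≤ u x) :
    (∀ x, gradient u x = 0) ∧ ∃ c : ℝ, ∀ x, u x = c := by
  have : Nonempty (Fin n) := ⟨⟨0, hn⟩⟩
  have hsub := sub_two_mul_lt_of_lt_criticalExponent hp hp'
  have hgrad : ∀ x, gradient u x = 0 :=
    gradient_eq_zero_of_nonneg_solution hp (by rwa [finrank_euclideanSpace_fin]) hu.contDiff
      hu_nonneg hu.equation
  refine ⟨hgrad, u 0, fun x => ?_⟩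
  refine is_const_of_fderiv_eq_zero (𝕜 := ℝ) (hu.contDiff.differentiable two_ne_zero)
    (fun y => ?_) x 0
  rw [← toDual_gradient, hgrad, map_zero]
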